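/- **Setting.** Consider the 1D Euler equations with gravity for an ideal gas with constant $\gamma>1$. States are $\mathbf U=(\rho,m,E)^\top$, with $u=m/\rho$, $e=\frac1\rho\big(E-\frac{m^2}{2\rho}\big)$, $p=(\gamma-1)\rho e$, flux $\mathbf F(\mathbf U)=(\rho u,\ \rho u^2+p,\ (E+p)u)^\top$, $\alpha_{\max}(\mathbf U)=|u|+\sqrt{\gamma p/\rho}$, and admissible set $$G=\Big\{\mathbf U:\ \rho>0,\ E-\tfrac{m^2}{2\rho}>0\Big\}.$$ Let $\mathbf F^{hllc}(\mathbf U_L,\mathbf U_R)$ be the HLLC flux: it equals $\mathbf F(\mathbf U_L)$ if $0\le S_L$, $\mathbf F_{*L}$ if $S_L\le 0\le S_*$, $\mathbf F_{*R}$ if $S_*\le 0\le S_R$, and $\mathbf F(\mathbf U_R)$ if $0\ge S_R$, where $S_L=\min_{i=L,R}\big(u_i-\sqrt{\gamma p_i/\rho_i}\big)$, $S_R=\max_{i=L,R}\big(u_i+\sqrt{\gamma p_i/\rho_i}\big)$, $$S_*=\frac{p_R-p_L+\rho_Lu_L(S_L-u_L)-\rho_Ru_R(S_R-u_R)}{\rho_L(S_L-u_L)-\rho_R(S_R-u_R)},\qquad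 \mathbf F_{*i}=\mathbf F(\mathbf U_i)+S_i(\mathbf U_{*i}-\mathbf U_i),$$ $$\mathbf U_{*i}=\rho_i\frac{S_i-u_i}{S_i-S_*}\Big(1,\ S_*,\ \frac{E_i}{\rho_i}+(S_*-u_i)\Big(S_*+\frac{p_i}{\rho_i(S_i-u_i)}\Big)\Big)^\top .$$ **Mesh and quadrature.** The domain $\Omega$ is divided into cells $I_j=(x_{j-1/2},x_{j+1/2})$, $j\in J\subset\mathbb Z$, of length $h_j>0$. $\mathbb V_h^k$ is the space of functions on $\Omega$ that are polynomials of degree $\le k$ on each cell; $\overline{(\cdot)}_j$ denotes the average over $I_j$, and $x_{j+1/2}^\mp$ the limits from the left and from the right. In each $I_j$ let $x_j^{(\mu)},\omega_\mu$ ($1\le\mu\le N$) be the points and the weights (with sum $1$) of the $N$-point Gauss rule, with $2N-1\ge k$, and let $\widehat x_j^{(\nu)}$ ($1\le\nu\le L$) be the points of the $L$-point Gauss–Lobatto rule, with $L\ge (k+3)/2$, whose normalised endpoint weight is $\widehat\omega_1=\frac1{L(L-1)}$. Let $\mathbb S_j$ be the set of all these Gauss and Gauss–Lobatto points of $I_j$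 (the values at the two endpoints being the limits from inside $I_j$). **Scheme.** Let $\rho_h^e,p_h^e\in\mathbb V_h^k$ (the projected equilibrium density and pressure) and $\mathbf U_h=(\rho_h,m_h,E_h)^\top\in[\mathbb V_h^k]^3$, $\mathbf U^\pm_{j+1/2}=\mathbf U_h(x^\pm_{j+1/2})$. At a boundary point of $\Omega$ (if there is one) the exterior limits of $\mathbf U_h$ and $p_h^e$ are given by boundary data. Put $p^{e,\star}_{j+1/2}=\frac12\big(p_h^e(x_{j+1/2}^-)+p_h^e(x_{j+1/2}^+)\big)$, $[\![p_h^e]\!]_{j+1/2}=p_h^e(x_{j+1/2}^+)-p_h^e(x_{j+1/2}^-)$, and $$\widehat{\mathbf F}_{j+\frac12}=\mathbf F^{hllc}\Big(\frac{p^{e,\star}_{j+1/2}}{p_h^e(x_{j+1/2}^-)}\mathbf U_{j+\frac12}^-,\ \frac{p^{e,\star}_{j+1/2}}{p_h^e(x_{j+1/2}^+)}\mathbf U_{j+\frac12}^+\Big).$$ For a polynomial $v$ and $(\ell,q)\in\{(2,\rho_h),(3,m_h)\}$ put $$\begin{aligned}\langle S^{[\ell]},v\rangle_j={}&h_j\sum_{\mu=1}^N\omega_\mu\Big(\frac{q(x_j^{(\mu)})}{\rho_h^e(x_j^{(\mu)})}-\frac{\overline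 q_j}{\overline{(\rho_h^e)}_j}\Big)(p_h^e)_x(x_j^{(\mu)})\,v(x_j^{(\mu)})\\&+\frac{\overline q_j}{\overline{(\rho_h^e)}_j}\Big(p^{e,\star}_{j+\frac12}v(x_{j+\frac12}^-)-p^{e,\star}_{j-\frac12}v(x_{j-\frac12}^+)-h_j\sum_{\mu=1}^N\omega_\mu\,p_h^e(x_j^{(\mu)})\,v_x(x_j^{(\mu)})\Big).\end{aligned}$$ The well-balanced DG scheme of degree $k$ is: for all $j\in J$ and all polynomials $v$ of degree $\le k$, $$\int_{I_j}(\mathbf U_h)_t\,v\,dx=h_j\sum_{\mu=1}^N\omega_\mu\mathbf F\big(\mathbf U_h(x_j^{(\mu)})\big)v_x(x_j^{(\mu)})-\Big(\widehat{\mathbf F}_{j+\frac12}v(x_{j+\frac12}^-)-\widehat{\mathbf F}_{j-\frac12}v(x_{j-\frac12}^+)\Big)+\big(0,\langle S^{[2]},v\rangle_j,\langle S^{[3]},v\rangle_j\big)^\top .$$ With $v=1$ the cell averages $\overline{\mathbf U}_j$ of $\mathbf U_h$ evolve by $$\frac{d\overline{\mathbf U}_j}{dt}=\mathbf L_j(\mathbf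 U_h):=-\frac1{h_j}\big(\widehat{\mathbf F}_{j+\frac12}-\widehat{\mathbf F}_{j-\frac12}\big)+\frac1{h_j}\big(0,\langle S^{[2]},1\rangle_j,\langle S^{[3]},1\rangle_j\big)^\top.$$ **CFL number.** With $e_h$ and $\overline e_j$ the specific internal energies of $\mathbf U_h$ and of $\overline{\mathbf U}_j$, let $\widetilde\alpha_j=\widetilde\alpha_j^F+\widetilde\alpha_j^S+\overline\alpha_j^S$ with $$\widetilde\alpha_j^F=2\max\Big\{\frac{p^{e,\star}_{j+1/2}}{p_h^e(x^-_{j+1/2})},\frac{p^{e,\star}_{j-1/2}}{p_h^e(x^+_{j-1/2})}\Big\}\max_{\mathbf U\in\{\mathbf U^\pm_{j-1/2},\mathbf U^\pm_{j+1/2}\}}\alpha_{\max}(\mathbf U),$$ $$\widetilde\alpha_j^S=\widehat\omega_1h_j\max_{1\le\mu\le N}\frac{|(p_h^e)_x(x_j^{(\mu)})|}{\rho_h^e(x_j^{(\mu)})\sqrt{2e_h(x_j^{(\mu)})}},\qquad \overline\alpha_j^S=\widehat\omega_1\frac{\big|[\![p_h^e]\!]_{j+1/2}+[\![p_h^e]\!]_{j-1/2}\big|}{2\,\overline{(\rho_h^e)}_j\sqrt{2\overline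 e_j}}.$$ **Theorem.** Assume that $\rho_h^e(x)>0$, $p_h^e(x)>0$ and $\mathbf U_h(x)\in G$ for all $x\in\mathbb S_j$ and all $j\in J$, and that at boundary points of $\Omega$ the exterior limits of $p_h^e$ are positive and those of $\mathbf U_h$ lie in $G$. If $\Delta t>0$ satisfies $$\widetilde\alpha_j\,\Delta t\le\widehat\omega_1h_j\qquad\text{for all } j\in J,$$ then $$\overline{\mathbf U}_j+\Delta t\,\mathbf L_j(\mathbf U_h)\in G\qquad\text{for all } j\in J.$$ In particular, if $\mathbf U_h^{new}\in[\mathbb V_h^k]^3$ results from $\mathbf U_h$ by one forward-Euler step of size $\Delta t$ of the DG scheme, then all its cell averages lie in $G$. -/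

import Mathlib

open Polynomial

namespace WBDG

noncomputable section

/-! ## One-dimensional Euler equations with the ideal-gas law -/

/-- A vector of conservative variables `(ρ, m, E)` (density, momentum, total energy). -/
abbrev State : Type := Fin 3 → ℝ

/-- The set `G` of admissible states: positive density and positive `E - m² / (2ρ)`. -/
def G : Set State := {U | 0 < U 0 ∧ 0 < U 2 - (U 1) ^ 2 / (2 * U 0)}

/-- Velocity `u = m / ρ`. -/
def velocity (U : State) : ℝ := U 1 / U 0

/-- Specific internal energy `e = (E - m² / (2ρ)) / ρ`. -/
def internalEnergy (U : State) : ℝ := (U 2 - (U 1) ^ 2 / (2 * U 0)) / U 0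

/-- Ideal-gas pressure `p = (γ - 1) (E - m² / (2ρ))`. -/
def pressure (γ : ℝ) (U : State) : ℝ := (γ - 1) * (U 2 - (U 1) ^ 2 / (2 * U 0))

/-- Sound speed `√(γ p / ρ)`. -/
def soundSpeed (γ : ℝ) (U : State) : ℝ := Real.sqrt (γ * pressure γ U / U 0)

/-- The Euler flux `F(U) = (ρ u, ρ u² + p, (E + p) u)`. -/
def eulerFlux (γ : ℝ) (U : State) : State :=
  ![U 0 * velocity U,
    U 0 * velocity U ^ 2 + pressure γ U,
    (U 2 + pressure γ U) * velocity U]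

/-- `α_max(U) = |u| + √(γ p / ρ)`. -/
def alphaMax (γ : ℝ) (U : State) : ℝ := |velocity U| + soundSpeed γ U

/-! ## The HLLC flux -/

/-- `S_L`, the smaller of `u - √(γ p / ρ)` over the two states. -/
def speedL (γ : ℝ) (UL UR : State) : ℝ :=
  min (velocity UL - soundSpeed γ UL) (velocity UR - soundSpeed γ UR)

/-- `S_R`, the larger of `u + √(γ p / ρ)` over the two states. -/
def speedR (γ : ℝ) (UL UR : State) : ℝ :=
  max (velocity UL + soundSpeed γ UL) (velocity UR + soundSpeed γ UR)

/-- The middle wave speed `S_*`. -/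
def speedStar (γ : ℝ) (UL UR : State) : ℝ :=
  (pressure γ UR - pressure γ UL
      + UL 0 * velocity UL * (speedL γ UL UR - velocity UL)
      - UR 0 * velocity UR * (speedR γ UL UR - velocity UR)) /
    (UL 0 * (speedL γ UL UR - velocity UL) - UR 0 * (speedR γ UL UR - velocity UR))

/-- The intermediate state `U_{*i}` next to `U = U_i`, with outer wave speed `S = S_i`
and middle wave speed `Sstar = S_*`. -/
def starState (γ : ℝ) (U : State) (S Sstar : ℝ) : State :=
  (U 0 * ((S - velocity U) / (S - Sstar))) •
    ![1,
      Sstar,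
      U 2 / U 0 +
        (Sstar - velocity U) * (Sstar + pressure γ U / (U 0 * (S - velocity U)))]

/-- The intermediate flux `F_{*i} = F(U_i) + S_i (U_{*i} - U_i)`. -/
def starFlux (γ : ℝ) (U : State) (S Sstar : ℝ) : State :=
  eulerFlux γ U + S • (starState γ U S Sstar - U)

/-- The HLLC numerical flux `F^hllc(U_L, U_R)`. -/
def hllc (γ : ℝ) (UL UR : State) : State :=
  if 0 ≤ speedL γ UL UR then eulerFlux γ UL
  else if 0 ≤ speedStar γ UL UR then starFlux γ UL (speedL γ UL UR) (speedStar γ UL UR)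
  else if 0 ≤ speedR γ UL UR then starFlux γ UR (speedR γ UL UR) (speedStar γ UL UR)
  else eulerFlux γ UR

/-! ## Quadrature rules on the reference interval `[-1, 1]` -/

/-- An `n`-point quadrature rule on `[-1, 1]`; the weights are normalised to the averaging
functional `f ↦ ½ ∫_{-1}^{1} f`. -/
structure QuadRule (n : ℕ) where
  node : Fin n → ℝ
  weight : Fin n → ℝ

/-- `r` integrates all polynomials of degree less than `d` exactly. -/
def QuadRule.ExactBelow {n : ℕ} (r : QuadRule n) (d : ℕ) : Prop :=
  ∀ q : ℝ[X], q.degree < d →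
    ∑ i, r.weight i * q.eval (r.node i) = (1 / 2) * ∫ t in (-1 : ℝ)..1, q.eval t

/-- The `n`-point Gauss rule: the `n`-point rule, with nodes in increasing order, of degree of
exactness `2n - 1`. -/
structure QuadRule.IsGauss {n : ℕ} (r : QuadRule n) : Prop where
  strictMono_node : StrictMono r.node
  exact : r.ExactBelow (2 * n)

/-- The `n`-point Gauss–Lobatto rule (`n ≥ 2`): the `n`-point rule, with nodes in increasing
order, that contains both endpoints and has degree of exactness `2n - 3`. -/
structure QuadRule.IsGaussLobatto {n : ℕ} (r : QuadRule n) : Prop where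
  two_le : 2 ≤ n
  strictMono_node : StrictMono r.node
  first_node : ∀ i : Fin n, (i : ℕ) = 0 → r.node i = -1
  last_node : ∀ i : Fin n, (i : ℕ) + 1 = n → r.node i = 1
  exact : r.ExactBelow (2 * n - 2)

/-! ## Mesh and discontinuous piecewise polynomials

The mesh is given by its nodes `x : ℤ → ℝ`; the cell with index `j` is `I_j = (x j, x (j + 1))`,
so `x j` stands for `x_{j-1/2}` and `x (j + 1)` for `x_{j+1/2}`. A set `J` of indices singles out
the cells that make up the spatial domain `Ω`; when `Ω` has a boundary, the cells outside `J` that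
are adjacent to `Ω` are ghost cells whose traces carry the boundary conditions. -/

/-- Length `h_j` of the cell `j`. -/
def cellSize (x : ℤ → ℝ) (j : ℤ) : ℝ := x (j + 1) - x j

/-- The point of the cell `j` which corresponds to the reference point `t ∈ [-1, 1]`. -/
def cellPoint (x : ℤ → ℝ) (j : ℤ) (t : ℝ) : ℝ :=
  (x j + x (j + 1)) / 2 + cellSize x j / 2 * t

/-- A scalar discontinuous piecewise polynomial, given by its polynomial on each cell. -/
abbrev PiecewisePoly : Type := ℤ → ℝ[X]

/-- A vector-valued piecewise polynomial, such as `U_h = (ρ_h, m_h, E_h)`. -/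
abbrev PiecewiseState : Type := ℤ → Fin 3 → ℝ[X]

/-- Membership in the space `V_h^k`: degree at most `k` on every cell of `Ω`. -/
def InVh (J : Set ℤ) (k : ℕ) (w : PiecewisePoly) : Prop :=
  ∀ j ∈ J, (w j).degree ≤ k

/-- Membership in `[V_h^k]³`. -/
def InVh3 (J : Set ℤ) (k : ℕ) (U : PiecewiseState) : Prop :=
  ∀ i : Fin 3, InVh J k (fun j => U j i)

/-- Value at the point `y` of the polynomial vector that `U` has on the cell `j`. At `y = x j`
and `y = x (j + 1)` this is the trace from inside the cell. -/
def valueAt (U : PiecewiseState) (j : ℤ) (y : ℝ) : State := fun i => (U j i).eval y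

/-- Cell average of a scalar piecewise polynomial. -/
def cellAverage (x : ℤ → ℝ) (w : PiecewisePoly) (j : ℤ) : ℝ :=
  (1 / cellSize x j) * ∫ y in (x j)..(x (j + 1)), (w j).eval y

/-- Cell average of a vector-valued piecewise polynomial. -/
def stateAverage (x : ℤ → ℝ) (U : PiecewiseState) (j : ℤ) : State :=
  fun i => cellAverage x (fun l => U l i) j

/-- The set `𝕊_j` of all Gauss–Lobatto points and all Gauss points of the cell `j`. -/
def pointSet {N L : ℕ} (gauss : QuadRule N) (lobatto : QuadRule L) (x : ℤ → ℝ) (j : ℤ) : Set ℝ :=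
  Set.range (fun ν => cellPoint x j (lobatto.node ν)) ∪
    Set.range (fun μ => cellPoint x j (gauss.node μ))

/-! ## The well-balanced DG scheme

The interface at `x j` (between the cells `j - 1` and `j`) has index `j`. -/

/-- The approximation `p^{e,⋆}` of the equilibrium pressure at the interface `j`: the mean of the
two one-sided limits of `p^e_h`. -/
def pStar (x : ℤ → ℝ) (pe : PiecewisePoly) (j : ℤ) : ℝ :=
  ((pe (j - 1)).eval (x j) + (pe j).eval (x j)) / 2

/-- The jump of `p^e_h` (right limit minus left limit) at the interface `j`. -/
def jump (x : ℤ → ℝ) (pe : PiecewisePoly) (j : ℤ) : ℝ :=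
  (pe j).eval (x j) - (pe (j - 1)).eval (x j)

/-- The modified HLLC flux at the interface `j`. -/
def modifiedFlux (γ : ℝ) (x : ℤ → ℝ) (pe : PiecewisePoly) (U : PiecewiseState) (j : ℤ) : State :=
  hllc γ
    ((pStar x pe j / (pe (j - 1)).eval (x j)) • valueAt U (j - 1) (x j))
    ((pStar x pe j / (pe j).eval (x j)) • valueAt U j (x j))

/-- The discrete source functional: `⟨S^[2], v⟩_j` for `q = ρ_h` and `⟨S^[3], v⟩_j` for
`q = m_h`. -/
def sourceForm {N : ℕ} (gauss : QuadRule N) (x : ℤ → ℝ) (ρe pe q : PiecewisePoly)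
    (j : ℤ) (v : ℝ[X]) : ℝ :=
  cellSize x j * ∑ μ, gauss.weight μ *
      (((q j).eval (cellPoint x j (gauss.node μ)) / (ρe j).eval (cellPoint x j (gauss.node μ))
          - cellAverage x q j / cellAverage x ρe j)
        * (derivative (pe j)).eval (cellPoint x j (gauss.node μ))
        * v.eval (cellPoint x j (gauss.node μ)))
    + cellAverage x q j / cellAverage x ρe j *
      (pStar x pe (j + 1) * v.eval (x (j + 1)) - pStar x pe j * v.eval (x j)
        - cellSize x j * ∑ μ, gauss.weight μ *
            ((pe j).eval (cellPoint x j (gauss.node μ))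
              * (derivative v).eval (cellPoint x j (gauss.node μ))))

/-- The vector `(0, ⟨S^[2], v⟩_j, ⟨S^[3], v⟩_j)`. -/
def sourceVector {N : ℕ} (gauss : QuadRule N) (x : ℤ → ℝ) (ρe pe : PiecewisePoly)
    (U : PiecewiseState) (j : ℤ) (v : ℝ[X]) : State :=
  ![0,
    sourceForm gauss x ρe pe (fun l => U l 0) j v,
    sourceForm gauss x ρe pe (fun l => U l 1) j v]

/-- Right-hand side of the semi-discrete weak form on the cell `j`, tested with `v`. -/
def weakRHS {N : ℕ} (γ : ℝ) (gauss : QuadRule N) (x : ℤ → ℝ) (ρe pe : PiecewisePoly)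
    (U : PiecewiseState) (j : ℤ) (v : ℝ[X]) : State :=
  cellSize x j • (∑ μ, (gauss.weight μ * (derivative v).eval (cellPoint x j (gauss.node μ))) •
      eulerFlux γ (valueAt U j (cellPoint x j (gauss.node μ))))
    - (v.eval (x (j + 1)) • modifiedFlux γ x pe U (j + 1)
        - v.eval (x j) • modifiedFlux γ x pe U j)
    + sourceVector gauss x ρe pe U j v

/-- `Unew ∈ [V_h^k]³` results from `U` by one forward-Euler step `Δt` of the DG scheme of
degree `k`, i.e. the weak form holds for all test functions with the time derivative replaced by
`(Unew - U) / Δt`. -/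
def IsForwardEulerStep {N : ℕ} (J : Set ℤ) (k : ℕ) (γ : ℝ) (gauss : QuadRule N) (x : ℤ → ℝ)
    (ρe pe : PiecewisePoly) (Δt : ℝ) (U Unew : PiecewiseState) : Prop :=
  InVh3 J k Unew ∧
    ∀ j ∈ J, ∀ v : ℝ[X], v.degree ≤ k → ∀ i : Fin 3,
      ∫ y in (x j)..(x (j + 1)), (Unew j i).eval y * v.eval y =
        (∫ y in (x j)..(x (j + 1)), (U j i).eval y * v.eval y)
          + Δt * weakRHS γ gauss x ρe pe U j v i

/-- The evolution operator of the cell averages,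
`L_j(U_h) = -(1 / h_j) (F̂_{j+1/2} - F̂_{j-1/2}) + (1 / h_j) (0, ⟨S^[2], 1⟩_j, ⟨S^[3], 1⟩_j)`. -/
def averageOperator {N : ℕ} (γ : ℝ) (gauss : QuadRule N) (x : ℤ → ℝ) (ρe pe : PiecewisePoly)
    (U : PiecewiseState) (j : ℤ) : State :=
  -((1 / cellSize x j) • (modifiedFlux γ x pe U (j + 1) - modifiedFlux γ x pe U j))
    + (1 / cellSize x j) • sourceVector gauss x ρe pe U j 1

/-! ## The CFL condition -/

/-- The normalised endpoint weight `ω̂₁ = 1 / (L (L - 1))` of the `L`-point Gauss–Lobatto rule. -/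
def omegaHat (L : ℕ) : ℝ := 1 / ((L : ℝ) * ((L : ℝ) - 1))

/-- `α̃_j^F`. -/
def alphaF (γ : ℝ) (x : ℤ → ℝ) (pe : PiecewisePoly) (U : PiecewiseState) (j : ℤ) : ℝ :=
  2 * max (pStar x pe (j + 1) / (pe j).eval (x (j + 1))) (pStar x pe j / (pe j).eval (x j))
    * max
        (max (alphaMax γ (valueAt U (j - 1) (x j))) (alphaMax γ (valueAt U j (x j))))
        (max (alphaMax γ (valueAt U j (x (j + 1))))
          (alphaMax γ (valueAt U (j + 1) (x (j + 1)))))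

/-- `α̃_j^S`; the supremum over the finitely many Gauss points is a maximum. -/
def alphaS {N : ℕ} (L : ℕ) (gauss : QuadRule N) (x : ℤ → ℝ) (ρe pe : PiecewisePoly)
    (U : PiecewiseState) (j : ℤ) : ℝ :=
  omegaHat L * cellSize x j *
    ⨆ μ : Fin N,
      |(derivative (pe j)).eval (cellPoint x j (gauss.node μ))| /
        ((ρe j).eval (cellPoint x j (gauss.node μ)) *
          Real.sqrt (2 * internalEnergy (valueAt U j (cellPoint x j (gauss.node μ)))))

/-- `ᾱ_j^S`. -/
def alphaSBar (L : ℕ) (x : ℤ → ℝ) (ρe pe : PiecewisePoly) (U : PiecewiseState) (j : ℤ) : ℝ :=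
  omegaHat L *
    (|jump x pe (j + 1) + jump x pe j| /
      (2 * cellAverage x ρe j * Real.sqrt (2 * internalEnergy (stateAverage x U j))))

/-- `α̃_j = α̃_j^F + α̃_j^S + ᾱ_j^S`. -/
def alphaTilde {N : ℕ} (L : ℕ) (γ : ℝ) (gauss : QuadRule N) (x : ℤ → ℝ) (ρe pe : PiecewisePoly)
    (U : PiecewiseState) (j : ℤ) : ℝ :=
  alphaF γ x pe U j + alphaS L gauss x ρe pe U j + alphaSBar L x ρe pe U j

end

end WBDG

/-!
A state is admissible iff its density and its total energy in every inertial frame are positive.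
These conditions are linear in the state, so `G` is a convex cone, and adding to an admissible
state a limit of admissible states keeps it admissible.

The HLLC flux is `F(U_L)` plus the jumps across the three waves of the HLLC fan weighted by
`min(S, 0)`, and also `F(U_R)` minus these jumps weighted by `max(S, 0)`. As the intermediate states
are admissible, so are `2 a U_L - F^hllc` and `2 a U_R + F^hllc` once `a` bounds the wave speeds.
A source `a (0, ρ, m)` changes the momentum at fixed density, and `s U` can afford it as long as
`|a| ≤ s √(2e)`.

The cell average is a convex combination of the values at the Lobatto points, and also of those at
the Gauss points. The part `α̃^F / (ω̂₁ h)` of the available multiple of the average, expanded at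
the Lobatto points, pays for the two interface fluxes; the part `α̃^S / (ω̂₁ h)`, expanded at the
Gauss points, pays for the source at these points; the part `ᾱ^S / (ω̂₁ h)` pays for the source of
the average itself, whose coefficient is a mean of jumps because the well-balanced source form
subtracts `∫ (p^e)_x`.
-/

namespace WBDG

/-! ## The cone of admissible states -/

/-- The total energy `E - v m + v² ρ / 2` that an observer moving with velocity `v` assigns to a
state; positivity of all of them replaces the nonlinear condition in `G` by linear ones. -/
noncomputable def frameEnergy (v : ℝ) : State →ₗ[ℝ] ℝ :=
  (v ^ 2 / 2) • LinearMap.proj 0 - v • LinearMap.proj 1 + LinearMap.proj 2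

theorem frameEnergy_apply (v : ℝ) (U : State) :
    frameEnergy v U = v ^ 2 / 2 * U 0 - v * U 1 + U 2 := by
  simp [frameEnergy]

theorem frameEnergy_eq (v : ℝ) {U : State} (hρ : U 0 ≠ 0) :
    frameEnergy v U = U 0 * (internalEnergy U + (velocity U - v) ^ 2 / 2) := by
  rw [frameEnergy_apply, internalEnergy, velocity]
  field_simp
  ring

theorem internalEnergy_pos {U : State} (hU : U ∈ G) : 0 < internalEnergy U :=
  div_pos hU.2 hU.1

theorem sqrt_two_mul_internalEnergy_pos {U : State} (hU : U ∈ G) :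
    0 < √(2 * internalEnergy U) :=
  Real.sqrt_pos.2 (mul_pos two_pos (internalEnergy_pos hU))

theorem mem_G_iff_frameEnergy_pos {U : State} : U ∈ G ↔ 0 < U 0 ∧ ∀ v, 0 < frameEnergy v U := by
  refine and_congr_right fun hρ => ⟨fun hE v => ?_, fun hE => ?_⟩
  · have he : 0 < internalEnergy U := div_pos hE hρ
    rw [frameEnergy_eq v hρ.ne']
    positivity
  · have he := frameEnergy_eq (velocity U) hρ.ne' ▸ hE (velocity U)
    rwa [internalEnergy, sub_self, zero_pow two_ne_zero, zero_div, add_zero,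
      mul_div_cancel₀ _ hρ.ne'] at he

/-- The closure of `G`, a convex cone: nonnegative density, and nonnegative energy in every
inertial frame. -/
def admissibleCone : PointedCone ℝ State where
  carrier := {U | 0 ≤ U 0 ∧ ∀ v, 0 ≤ frameEnergy v U}
  zero_mem' := by simp
  add_mem' hU hV := ⟨add_nonneg hU.1 hV.1, fun v => by
    rw [map_add]
    exact add_nonneg (hU.2 v) (hV.2 v)⟩
  smul_mem' c U hU := ⟨mul_nonneg c.2 hU.1, fun v => by
    rw [← Nonneg.coe_smul, map_smul]
    exact mul_nonneg c.2 (hU.2 v)⟩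

theorem G_subset_admissibleCone : G ⊆ admissibleCone := fun _ hU =>
  have hU := mem_G_iff_frameEnergy_pos.1 hU
  ⟨hU.1.le, fun v => (hU.2 v).le⟩

theorem add_mem_G {U V : State} (hU : U ∈ G) (hV : V ∈ admissibleCone) : U + V ∈ G := by
  rw [mem_G_iff_frameEnergy_pos] at hU ⊢
  refine ⟨add_pos_of_pos_of_nonneg hU.1 hV.1, fun v => ?_⟩
  rw [map_add]
  exact add_pos_of_pos_of_nonneg (hU.2 v) (hV.2 v)

theorem smul_mem_G {U : State} (hU : U ∈ G) {c : ℝ} (hc : 0 < c) : c • U ∈ G := by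
  rw [mem_G_iff_frameEnergy_pos] at hU ⊢
  refine ⟨mul_pos hc hU.1, fun v => ?_⟩
  rw [map_smul]
  exact mul_pos hc (hU.2 v)

theorem smul_mem_admissibleCone {U : State} (hU : U ∈ G) {c : ℝ} (hc : 0 ≤ c) :
    c • U ∈ admissibleCone :=
  PointedCone.smul_mem _ hc (G_subset_admissibleCone hU)

theorem convex_G : Convex ℝ G := by
  refine convex_iff_forall_pos.2 fun U hU V hV a b ha hb _ => ?_
  exact add_mem_G (smul_mem_G hU ha) (smul_mem_admissibleCone hV hb.le)

/-! ## Impulses -/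

theorem smul_add_impulse_mem_admissibleCone {U : State} (hU : U ∈ G) {s b : ℝ}
    (hb : |b| ≤ s * (U 0 * √(2 * internalEnergy U))) :
    s • U + b • ![0, 1, velocity U] ∈ admissibleCone := by
  have hρ := hU.1
  have hr := sqrt_two_mul_internalEnergy_pos hU
  have hr_sq := Real.sq_sqrt (mul_nonneg zero_le_two (internalEnergy_pos hU).le)
  set r := √(2 * internalEnergy U)
  have hs : 0 ≤ s := nonneg_of_mul_nonneg_left ((abs_nonneg b).trans hb) (mul_pos hρ hr)
  refine ⟨by simpa using mul_nonneg hs hρ.le, fun v => ?_⟩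
  set w := velocity U - v with hw
  have hkick : frameEnergy v ![0, 1, velocity U] = w := by
    simp [frameEnergy_apply, hw]
    ring
  have hbw : -(s * (U 0 * r) * |w|) ≤ b * w :=
    (neg_le_neg (by rw [abs_mul]; gcongr)).trans (neg_abs_le (b * w))
  calc 0 ≤ s * U 0 / 2 * (r - |w|) ^ 2 := by positivity
    _ = s * (U 0 * (internalEnergy U + w ^ 2 / 2)) + -(s * (U 0 * r) * |w|) := by
        rw [sub_sq, sq_abs, hr_sq]
        ring
    _ ≤ s * (U 0 * (internalEnergy U + w ^ 2 / 2)) + b * w := by gcongr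
    _ = frameEnergy v (s • U + b • ![0, 1, velocity U]) := by
        rw [map_add, map_smul, map_smul, hkick, frameEnergy_eq v hρ.ne', smul_eq_mul, smul_eq_mul]

theorem smul_add_impulse_mem_G {U : State} (hU : U ∈ G) {s b : ℝ}
    (hb : |b| < s * (U 0 * √(2 * internalEnergy U))) :
    s • U + b • ![0, 1, velocity U] ∈ G := by
  have hpos := mul_pos hU.1 (sqrt_two_mul_internalEnergy_pos hU)
  set r := U 0 * √(2 * internalEnergy U)
  have hcone : (|b| / r) • U + b • ![0, 1, velocity U] ∈ admissibleCone :=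
    smul_add_impulse_mem_admissibleCone hU (div_mul_cancel₀ _ hpos.ne').ge
  convert add_mem_G (smul_mem_G hU (sub_pos.2 ((div_lt_iff₀ hpos).2 hb))) hcone using 1
  module

/-- The source `(0, ρ, m)` of a unit gravitational acceleration acting on a state. -/
def gravitySource (U : State) : State := ![0, U 0, U 1]

theorem gravitySource_eq {U : State} (hρ : U 0 ≠ 0) :
    gravitySource U = U 0 • ![0, 1, velocity U] := by
  simp [gravitySource, velocity, mul_div_cancel₀ _ hρ]

theorem smul_add_gravitySource_mem_admissibleCone {U : State} (hU : U ∈ G) {s a : ℝ}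
    (ha : |a| ≤ s * √(2 * internalEnergy U)) :
    s • U + a • gravitySource U ∈ admissibleCone := by
  have hρ := hU.1
  rw [gravitySource_eq hρ.ne', smul_smul]
  refine smul_add_impulse_mem_admissibleCone hU ?_
  rw [abs_mul, abs_of_pos hρ, mul_left_comm, mul_comm |a|]
  gcongr

/-! ## Ideal gas -/

theorem velocity_smul {c : ℝ} (hc : c ≠ 0) (U : State) : velocity (c • U) = velocity U :=
  mul_div_mul_left _ _ hc

theorem pressure_smul (γ : ℝ) {c : ℝ} (hc : c ≠ 0) (U : State) :
    pressure γ (c • U) = c * pressure γ U := by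
  simp only [pressure, Pi.smul_apply, smul_eq_mul]
  field_simp

theorem alphaMax_smul (γ : ℝ) {c : ℝ} (hc : c ≠ 0) (U : State) :
    alphaMax γ (c • U) = alphaMax γ U := by
  rw [alphaMax, alphaMax, soundSpeed, soundSpeed, velocity_smul hc, pressure_smul γ hc,
    mul_left_comm, Pi.smul_apply, smul_eq_mul, mul_div_mul_left _ _ hc]

theorem pressure_eq (γ : ℝ) {U : State} (hρ : U 0 ≠ 0) :
    pressure γ U = (γ - 1) * (U 0 * internalEnergy U) := by
  rw [pressure, internalEnergy, mul_div_cancel₀ _ hρ]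

section Gas

variable {γ : ℝ} {U : State}

theorem pressure_pos (hγ : 1 < γ) (hU : U ∈ G) : 0 < pressure γ U :=
  mul_pos (sub_pos.2 hγ) hU.2

theorem soundSpeed_pos (hγ : 1 < γ) (hU : U ∈ G) : 0 < soundSpeed γ U :=
  Real.sqrt_pos.2 (div_pos (mul_pos (zero_lt_one.trans hγ) (pressure_pos hγ hU)) hU.1)

theorem density_mul_soundSpeed_sq (hγ : 1 < γ) (hU : U ∈ G) :
    U 0 * soundSpeed γ U ^ 2 = γ * pressure γ U := by
  have hp := pressure_pos hγ hU
  have hρ := hU.1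
  rw [soundSpeed, Real.sq_sqrt (by positivity), mul_div_cancel₀ _ hρ.ne']

theorem pressure_lt_density_mul_soundSpeed_mul_sqrt (hγ : 1 < γ) (hU : U ∈ G) :
    pressure γ U < soundSpeed γ U * (U 0 * √(2 * internalEnergy U)) := by
  have hρ := hU.1
  have hc := soundSpeed_pos hγ hU
  have hp := pressure_pos hγ hU
  have he := internalEnergy_pos hU
  refine lt_of_pow_lt_pow_left₀ 2 (by positivity) ?_
  calc pressure γ U ^ 2 = pressure γ U * ((γ - 1) * (U 0 * internalEnergy U)) := by
        rw [← pressure_eq γ hρ.ne', sq]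
    _ < pressure γ U * ((2 * γ) * (U 0 * internalEnergy U)) := by
        gcongr
        linarith
    _ = U 0 * soundSpeed γ U ^ 2 * (U 0 * (2 * internalEnergy U)) := by
        rw [density_mul_soundSpeed_sq hγ hU]
        ring
    _ = (soundSpeed γ U * (U 0 * √(2 * internalEnergy U))) ^ 2 := by
        rw [mul_pow, mul_pow, Real.sq_sqrt (by positivity)]
        ring

theorem pressure_lt_density_mul_soundSpeed_sq (hγ : 1 < γ) (hU : U ∈ G) :
    pressure γ U < U 0 * soundSpeed γ U ^ 2 := by
  rw [density_mul_soundSpeed_sq hγ hU]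
  exact lt_mul_of_one_lt_left (pressure_pos hγ hU) hγ

theorem alphaMax_pos (hγ : 1 < γ) (hU : U ∈ G) : 0 < alphaMax γ U :=
  add_pos_of_nonneg_of_pos (abs_nonneg _) (soundSpeed_pos hγ hU)

theorem eulerFlux_eq (γ : ℝ) (hρ : U 0 ≠ 0) :
    eulerFlux γ U = velocity U • U + pressure γ U • ![0, 1, velocity U] := by
  have hm : U 1 = U 0 * velocity U := (mul_div_cancel₀ _ hρ).symm
  ext i
  fin_cases i
  · simp [eulerFlux, mul_comm]
  · simp [eulerFlux, hm]
    ring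
  · simp [eulerFlux]
    ring

theorem smul_add_pressure_mem_G (hγ : 1 < γ) (hU : U ∈ G) {s b : ℝ}
    (hs : soundSpeed γ U ≤ s) (hb : |b| = pressure γ U) :
    s • U + b • ![0, 1, velocity U] ∈ G := by
  have hpos := mul_pos hU.1 (sqrt_two_mul_internalEnergy_pos hU)
  refine smul_add_impulse_mem_G hU (hb.trans_lt ?_)
  exact (pressure_lt_density_mul_soundSpeed_mul_sqrt hγ hU).trans_le
    (mul_le_mul_of_nonneg_right hs hpos.le)

theorem smul_sub_eulerFlux_mem_G (hγ : 1 < γ) (hU : U ∈ G) {a : ℝ} (ha : alphaMax γ U ≤ a) :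
    a • U - eulerFlux γ U ∈ G := by
  have hs : soundSpeed γ U ≤ a - velocity U := by
    unfold alphaMax at ha
    linarith [le_abs_self (velocity U)]
  have hb : |-pressure γ U| = pressure γ U := by rw [abs_neg, abs_of_pos (pressure_pos hγ hU)]
  convert smul_add_pressure_mem_G hγ hU hs hb using 1
  rw [eulerFlux_eq γ hU.1.ne']
  module

theorem smul_add_eulerFlux_mem_G (hγ : 1 < γ) (hU : U ∈ G) {a : ℝ} (ha : alphaMax γ U ≤ a) :
    a • U + eulerFlux γ U ∈ G := by
  have hs : soundSpeed γ U ≤ a + velocity U := by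
    unfold alphaMax at ha
    linarith [neg_abs_le (velocity U)]
  convert smul_add_pressure_mem_G hγ hU hs (abs_of_pos (pressure_pos hγ hU)) using 1
  rw [eulerFlux_eq γ hU.1.ne']
  module

end Gas

/-! ## The HLLC flux -/

section Riemann

variable {γ : ℝ} {U UL UR : State}

theorem starState_mem_G (hγ : 1 < γ) (hU : U ∈ G) {S T : ℝ}
    (hS : soundSpeed γ U ≤ |S - velocity U|) (hT : 0 < (S - velocity U) / (S - T)) :
    starState γ U S T ∈ G := by
  have hρ := hU.1
  have hpos : 0 < |S - velocity U| := (soundSpeed_pos hγ hU).trans_le hS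
  refine smul_mem_G ⟨one_pos, ?_⟩ (mul_pos hρ hT)
  set r := pressure γ U / (U 0 * (S - velocity U)) with hr
  have hr_lt : |r| < √(2 * internalEnergy U) := by
    have hrS : |r| * (U 0 * |S - velocity U|) = pressure γ U := by
      rw [hr, abs_div, abs_mul, abs_of_pos hρ, abs_of_pos (pressure_pos hγ hU)]
      field_simp
    refine lt_of_mul_lt_mul_right ?_ (mul_pos hρ hpos).le
    calc |r| * (U 0 * |S - velocity U|) < soundSpeed γ U * (U 0 * √(2 * internalEnergy U)) :=
          hrS.trans_lt (pressure_lt_density_mul_soundSpeed_mul_sqrt hγ hU)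
      _ ≤ |S - velocity U| * (U 0 * √(2 * internalEnergy U)) := by gcongr
      _ = √(2 * internalEnergy U) * (U 0 * |S - velocity U|) := by ring
  have hr_sq : r ^ 2 < 2 * internalEnergy U := sq_abs r ▸ (Real.lt_sqrt (abs_nonneg r)).1 hr_lt
  have hE : U 2 / U 0 = internalEnergy U + velocity U ^ 2 / 2 := by
    rw [internalEnergy, velocity]
    field_simp
    ring
  have henergy : U 2 / U 0 + (T - velocity U) * (T + r) - T ^ 2 / (2 * 1) =
      (internalEnergy U - r ^ 2 / 2) + (T - velocity U + r) ^ 2 / 2 := by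
    rw [hE]
    ring
  simp only [Matrix.cons_val]
  rw [henergy]
  have hinternal : 0 < internalEnergy U - r ^ 2 / 2 := by linarith
  positivity

/-- The coefficient of `(0, 1, T)` is the pressure between the wave `S` and the contact `T`. -/
theorem starFlux_eq (γ : ℝ) (hρ : U 0 ≠ 0) {S T : ℝ} (hS : S - velocity U ≠ 0) (hT : S - T ≠ 0) :
    starFlux γ U S T = T • starState γ U S T +
      (pressure γ U + U 0 * (S - velocity U) * (T - velocity U)) • ![0, 1, T] := by
  have hm : U 1 = U 0 * velocity U := (mul_div_cancel₀ _ hρ).symm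
  unfold starFlux starState
  ext i
  fin_cases i
  · simp [eulerFlux, Matrix.vecHead, Matrix.vecTail]
    field_simp
    ring
  · simp [eulerFlux, Matrix.vecHead, Matrix.vecTail, hm]
    field_simp
    ring
  · simp [eulerFlux, Matrix.vecHead, Matrix.vecTail]
    field_simp
    ring

theorem speedL_le_left (γ : ℝ) (UL UR : State) :
    speedL γ UL UR ≤ velocity UL - soundSpeed γ UL :=
  min_le_left _ _

theorem speedL_le_right (γ : ℝ) (UL UR : State) :
    speedL γ UL UR ≤ velocity UR - soundSpeed γ UR :=
  min_le_right _ _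

theorem left_le_speedR (γ : ℝ) (UL UR : State) :
    velocity UL + soundSpeed γ UL ≤ speedR γ UL UR :=
  le_max_left _ _

theorem right_le_speedR (γ : ℝ) (UL UR : State) :
    velocity UR + soundSpeed γ UR ≤ speedR γ UL UR :=
  le_max_right _ _

theorem neg_le_speedL {a : ℝ} (hL : alphaMax γ UL ≤ a) (hR : alphaMax γ UR ≤ a) :
    -a ≤ speedL γ UL UR := by
  unfold alphaMax at hL hR
  exact le_min (by linarith [neg_abs_le (velocity UL)]) (by linarith [neg_abs_le (velocity UR)])

theorem speedR_le {a : ℝ} (hL : alphaMax γ UL ≤ a) (hR : alphaMax γ UR ≤ a) :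
    speedR γ UL UR ≤ a := by
  unfold alphaMax at hL hR
  exact max_le (by linarith [le_abs_self (velocity UL)]) (by linarith [le_abs_self (velocity UR)])

theorem speedL_lt_velocity_left (hγ : 1 < γ) (hUL : UL ∈ G) : speedL γ UL UR < velocity UL :=
  (speedL_le_left γ UL UR).trans_lt (sub_lt_self _ (soundSpeed_pos hγ hUL))

theorem velocity_right_lt_speedR (hγ : 1 < γ) (hUR : UR ∈ G) : velocity UR < speedR γ UL UR :=
  (lt_add_of_pos_right _ (soundSpeed_pos hγ hUR)).trans_le (right_le_speedR γ UL UR)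

theorem speedStar_denom_neg (hγ : 1 < γ) (hUL : UL ∈ G) (hUR : UR ∈ G) :
    UL 0 * (speedL γ UL UR - velocity UL) - UR 0 * (speedR γ UL UR - velocity UR) < 0 :=
  sub_neg.2 <|
    (mul_neg_of_pos_of_neg hUL.1 (sub_neg.2 (speedL_lt_velocity_left hγ hUL))).trans
      (mul_pos hUR.1 (sub_pos.2 (velocity_right_lt_speedR hγ hUR)))

theorem pressure_lt_density_mul_mul (hγ : 1 < γ) (hU : U ∈ G) {s t : ℝ}
    (hs : soundSpeed γ U ≤ s) (ht : soundSpeed γ U ≤ t) : pressure γ U < U 0 * (s * t) := by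
  have hρ := hU.1
  have hc := soundSpeed_pos hγ hU
  have hs_pos := hc.trans_le hs
  calc pressure γ U < U 0 * (soundSpeed γ U * soundSpeed γ U) := by
        rw [← sq]
        exact pressure_lt_density_mul_soundSpeed_sq hγ hU
    _ ≤ U 0 * (s * t) := by gcongr

theorem speedL_lt_speedStar (hγ : 1 < γ) (hUL : UL ∈ G) (hUR : UR ∈ G) :
    speedL γ UL UR < speedStar γ UL UR := by
  rw [speedStar, lt_div_iff_of_neg (speedStar_denom_neg hγ hUL hUR)]
  have hpR := pressure_lt_density_mul_mul hγ hUR (le_sub_iff_add_le'.2 (right_le_speedR γ UL UR))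
    (le_sub_comm.1 (speedL_le_right γ UL UR))
  have hpL := pressure_pos hγ hUL
  have hsq := mul_nonneg hUL.1.le (sq_nonneg (speedL γ UL UR - velocity UL))
  linarith

theorem speedStar_lt_speedR (hγ : 1 < γ) (hUL : UL ∈ G) (hUR : UR ∈ G) :
    speedStar γ UL UR < speedR γ UL UR := by
  rw [speedStar, div_lt_iff_of_neg (speedStar_denom_neg hγ hUL hUR)]
  have hpL := pressure_lt_density_mul_mul hγ hUL (le_sub_comm.1 (speedL_le_left γ UL UR))
    (le_sub_iff_add_le'.2 (left_le_speedR γ UL UR))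
  have hpR := pressure_pos hγ hUR
  have hsq := mul_nonneg hUR.1.le (sq_nonneg (speedR γ UL UR - velocity UR))
  linarith

/-- The state `U_{*L}` of the HLLC fan, between the left wave and the contact. -/
noncomputable def leftStarState (γ : ℝ) (UL UR : State) : State :=
  starState γ UL (speedL γ UL UR) (speedStar γ UL UR)

/-- The state `U_{*R}` of the HLLC fan, between the contact and the right wave. -/
noncomputable def rightStarState (γ : ℝ) (UL UR : State) : State :=
  starState γ UR (speedR γ UL UR) (speedStar γ UL UR)

theorem leftStarState_mem_G (hγ : 1 < γ) (hUL : UL ∈ G) (hUR : UR ∈ G) :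
    leftStarState γ UL UR ∈ G := by
  refine starState_mem_G hγ hUL ?_ <| div_pos_of_neg_of_neg
    (sub_neg.2 (speedL_lt_velocity_left hγ hUL)) (sub_neg.2 (speedL_lt_speedStar hγ hUL hUR))
  rw [abs_sub_comm]
  exact (le_sub_comm.1 (speedL_le_left γ UL UR)).trans (le_abs_self _)

theorem rightStarState_mem_G (hγ : 1 < γ) (hUL : UL ∈ G) (hUR : UR ∈ G) :
    rightStarState γ UL UR ∈ G :=
  starState_mem_G hγ hUR
    ((le_sub_iff_add_le'.2 (right_le_speedR γ UL UR)).trans (le_abs_self _)) <|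
    div_pos (sub_pos.2 (velocity_right_lt_speedR hγ hUR))
      (sub_pos.2 (speedStar_lt_speedR hγ hUL hUR))

/-- The Rankine–Hugoniot condition at the contact; `S_*` is defined by the equality of the two
pressures. -/
theorem starFlux_right_sub_starFlux_left (hγ : 1 < γ) (hUL : UL ∈ G) (hUR : UR ∈ G) :
    starFlux γ UR (speedR γ UL UR) (speedStar γ UL UR) -
        starFlux γ UL (speedL γ UL UR) (speedStar γ UL UR) =
      speedStar γ UL UR • (rightStarState γ UL UR - leftStarState γ UL UR) := by
  have hpressure : pressure γ UR
        + UR 0 * (speedR γ UL UR - velocity UR) * (speedStar γ UL UR - velocity UR) =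
      pressure γ UL
        + UL 0 * (speedL γ UL UR - velocity UL) * (speedStar γ UL UR - velocity UL) := by
    have hstar := div_mul_cancel₀ (pressure γ UR - pressure γ UL
      + UL 0 * velocity UL * (speedL γ UL UR - velocity UL)
      - UR 0 * velocity UR * (speedR γ UL UR - velocity UR)) (speedStar_denom_neg hγ hUL hUR).ne
    rw [← speedStar] at hstar
    linarith
  rw [starFlux_eq γ hUL.1.ne' (sub_neg.2 (speedL_lt_velocity_left hγ hUL)).ne
      (sub_neg.2 (speedL_lt_speedStar hγ hUL hUR)).ne,
    starFlux_eq γ hUR.1.ne' (sub_pos.2 (velocity_right_lt_speedR hγ hUR)).ne'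
      (sub_pos.2 (speedStar_lt_speedR hγ hUL hUR)).ne',
    hpressure, leftStarState, rightStarState]
  module

theorem eulerFlux_right_sub_eulerFlux_left (hγ : 1 < γ) (hUL : UL ∈ G) (hUR : UR ∈ G) :
    eulerFlux γ UR - eulerFlux γ UL =
      speedL γ UL UR • (leftStarState γ UL UR - UL)
      + speedStar γ UL UR • (rightStarState γ UL UR - leftStarState γ UL UR)
      + speedR γ UL UR • (UR - rightStarState γ UL UR) := by
  rw [← starFlux_right_sub_starFlux_left hγ hUL hUR, starFlux, starFlux, ← leftStarState,
    ← rightStarState]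
  module

theorem hllc_eq_eulerFlux_left_add (hγ : 1 < γ) (hUL : UL ∈ G) (hUR : UR ∈ G) :
    hllc γ UL UR = eulerFlux γ UL
      + min (speedL γ UL UR) 0 • (leftStarState γ UL UR - UL)
      + min (speedStar γ UL UR) 0 • (rightStarState γ UL UR - leftStarState γ UL UR)
      + min (speedR γ UL UR) 0 • (UR - rightStarState γ UL UR) := by
  have hSL := speedL_lt_speedStar hγ hUL hUR
  have hSR := speedStar_lt_speedR hγ hUL hUR
  unfold hllc
  split_ifs with hL hS hR
  · rw [min_eq_right hL, min_eq_right (hL.trans hSL.le),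
      min_eq_right ((hL.trans hSL.le).trans hSR.le)]
    module
  · rw [min_eq_left (not_le.1 hL).le, min_eq_right hS, min_eq_right (hS.trans hSR.le), starFlux,
      ← leftStarState]
    module
  · rw [min_eq_left (not_le.1 hL).le, min_eq_left (not_le.1 hS).le, min_eq_right hR,
      sub_eq_iff_eq_add.1 (starFlux_right_sub_starFlux_left hγ hUL hUR), starFlux, ← leftStarState]
    module
  · rw [min_eq_left (not_le.1 hL).le, min_eq_left (not_le.1 hS).le, min_eq_left (not_le.1 hR).le,
      sub_eq_iff_eq_add.1 (eulerFlux_right_sub_eulerFlux_left hγ hUL hUR)]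
    module

theorem hllc_eq_eulerFlux_right_sub (hγ : 1 < γ) (hUL : UL ∈ G) (hUR : UR ∈ G) :
    hllc γ UL UR = eulerFlux γ UR
      - max (speedL γ UL UR) 0 • (leftStarState γ UL UR - UL)
      - max (speedStar γ UL UR) 0 • (rightStarState γ UL UR - leftStarState γ UL UR)
      - max (speedR γ UL UR) 0 • (UR - rightStarState γ UL UR) := by
  have hmin (S : ℝ) : min S 0 = S - max S 0 := by linarith [min_add_max S 0]
  rw [hllc_eq_eulerFlux_left_add hγ hUL hUR, hmin, hmin, hmin,
    sub_eq_iff_eq_add.1 (eulerFlux_right_sub_eulerFlux_left hγ hUL hUR)]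
  module

theorem smul_left_sub_hllc_mem_G (hγ : 1 < γ) (hUL : UL ∈ G) (hUR : UR ∈ G) {a : ℝ}
    (hL : alphaMax γ UL ≤ a) (hR : alphaMax γ UR ≤ a) :
    (2 * a) • UL - hllc γ UL UR ∈ G := by
  have ha : 0 ≤ a + min (speedL γ UL UR) 0 := by
    rw [← neg_le_iff_add_nonneg']
    exact le_min (neg_le_speedL hL hR) (neg_nonpos.2 ((alphaMax_pos hγ hUL).le.trans hL))
  have hSL := min_le_min_right 0 (speedL_lt_speedStar hγ hUL hUR).le
  have hSR := min_le_min_right 0 (speedStar_lt_speedR hγ hUL hUR).le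
  convert add_mem_G (smul_sub_eulerFlux_mem_G hγ hUL hL) <|
    add_mem (add_mem (add_mem
      (smul_mem_admissibleCone hUL ha)
      (smul_mem_admissibleCone (leftStarState_mem_G hγ hUL hUR) (sub_nonneg.2 hSL)))
      (smul_mem_admissibleCone (rightStarState_mem_G hγ hUL hUR) (sub_nonneg.2 hSR)))
      (smul_mem_admissibleCone hUR (neg_nonneg.2 (min_le_right (speedR γ UL UR) 0))) using 1
  rw [hllc_eq_eulerFlux_left_add hγ hUL hUR]
  module

theorem smul_right_add_hllc_mem_G (hγ : 1 < γ) (hUL : UL ∈ G) (hUR : UR ∈ G) {a : ℝ}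
    (hL : alphaMax γ UL ≤ a) (hR : alphaMax γ UR ≤ a) :
    (2 * a) • UR + hllc γ UL UR ∈ G := by
  have ha : max (speedR γ UL UR) 0 ≤ a :=
    max_le (speedR_le hL hR) ((alphaMax_pos hγ hUL).le.trans hL)
  have hSL := max_le_max_right 0 (speedL_lt_speedStar hγ hUL hUR).le
  have hSR := max_le_max_right 0 (speedStar_lt_speedR hγ hUL hUR).le
  convert add_mem_G (smul_add_eulerFlux_mem_G hγ hUR hR) <|
    add_mem (add_mem (add_mem
      (smul_mem_admissibleCone hUL (le_max_right (speedL γ UL UR) 0))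
      (smul_mem_admissibleCone (leftStarState_mem_G hγ hUL hUR) (sub_nonneg.2 hSL)))
      (smul_mem_admissibleCone (rightStarState_mem_G hγ hUL hUR) (sub_nonneg.2 hSR)))
      (smul_mem_admissibleCone hUR (sub_nonneg.2 ha)) using 1
  rw [hllc_eq_eulerFlux_right_sub hγ hUL hUR]
  module

end Riemann

/-! ## Quadrature on the reference interval -/

theorem intervalIntegrable_eval (q : ℝ[X]) (a b : ℝ) :
    IntervalIntegrable (fun t => q.eval t) MeasureTheory.volume a b :=
  q.continuous.intervalIntegrable a b

theorem integral_eval_derivative (q : ℝ[X]) (a b : ℝ) :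
    ∫ t in a..b, (derivative q).eval t = q.eval b - q.eval a :=
  intervalIntegral.integral_eq_sub_of_hasDerivAt (fun t _ => q.hasDerivAt t)
    (intervalIntegrable_eval _ _ _)

/-- The average of a polynomial over `[-1, 1]`, the functional which the quadrature rules
approximate. -/
noncomputable def refAverage : ℝ[X] →ₗ[ℝ] ℝ where
  toFun q := (1 / 2) * ∫ t in (-1 : ℝ)..1, q.eval t
  map_add' p q := by
    simp only [eval_add]
    rw [intervalIntegral.integral_add (intervalIntegrable_eval p _ _)
      (intervalIntegrable_eval q _ _), mul_add]
  map_smul' c q := by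
    simp only [eval_smul, smul_eq_mul, RingHom.id_apply]
    rw [intervalIntegral.integral_const_mul, mul_left_comm]

theorem refAverage_one : refAverage 1 = 1 := by
  change (1 / 2 : ℝ) * ∫ t in (-1 : ℝ)..1, (1 : ℝ[X]).eval t = 1
  norm_num

theorem refAverage_derivative (q : ℝ[X]) :
    refAverage (derivative q) = (q.eval 1 - q.eval (-1)) / 2 := by
  rw [← integral_eval_derivative, div_eq_inv_mul, ← one_div]
  rfl

theorem refAverage_derivative_mul (p q : ℝ[X]) :
    refAverage (derivative p * q) =
      (p.eval 1 * q.eval 1 - p.eval (-1) * q.eval (-1)) / 2 - refAverage (p * derivative q) := by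
  rw [eq_sub_iff_add_eq, ← map_add, ← derivative_mul, refAverage_derivative, eval_mul, eval_mul]

theorem refAverage_pos {q : ℝ[X]} (hq : q ≠ 0) (hnonneg : ∀ t ∈ Set.Icc (-1 : ℝ) 1, 0 ≤ q.eval t) :
    0 < refAverage q := by
  refine mul_pos one_half_pos (intervalIntegral.integral_pos (by norm_num)
    q.continuous.continuousOn (fun t ht => hnonneg t (Set.Ioc_subset_Icc_self ht)) ?_)
  by_contra! hnonpos
  refine hq (eq_zero_of_infinite_isRoot q ?_)
  exact (Set.Icc_infinite (by norm_num : (-1 : ℝ) < 1)).mono fun t ht =>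
    le_antisymm (hnonpos t ht) (hnonneg t ht)

theorem monic_X_sq_sub_one : (X ^ 2 - 1 : ℝ[X]).Monic := by
  monicity!

theorem natDegree_X_sq_sub_one : (X ^ 2 - 1 : ℝ[X]).natDegree = 2 := by
  compute_degree!

theorem natDegree_X_sq_sub_one_mul (q : ℝ[X]) (hq : q ≠ 0) :
    ((X ^ 2 - 1) * q).natDegree = q.natDegree + 2 := by
  rw [natDegree_mul monic_X_sq_sub_one.ne_zero hq, natDegree_X_sq_sub_one, add_comm]

theorem one_sub_X_sq_ne_zero : (1 - X ^ 2 : ℝ[X]) ≠ 0 := by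
  rw [← neg_sub]
  exact neg_ne_zero.2 monic_X_sq_sub_one.ne_zero

theorem refAverage_one_sub_X_sq_mul_sq_pos {q : ℝ[X]} (hq : q ≠ 0) :
    0 < refAverage ((1 - X ^ 2) * q ^ 2) := by
  refine refAverage_pos (mul_ne_zero one_sub_X_sq_ne_zero (pow_ne_zero 2 hq)) fun t ht => ?_
  have ht_sq : 0 ≤ 1 - t ^ 2 := by nlinarith [ht.1, ht.2]
  simpa using mul_nonneg ht_sq (sq_nonneg (q.eval t))

namespace QuadRule

variable {n d : ℕ} {r : QuadRule n}

theorem ExactBelow.mono {d' : ℕ} (h : r.ExactBelow d) (hd : d' ≤ d) : r.ExactBelow d' :=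
  fun q hq => h q (hq.trans_le (by exact_mod_cast hd))

theorem ExactBelow.sum_eq (h : r.ExactBelow d) {q : ℝ[X]} (hq : q.natDegree < d) :
    ∑ i, r.weight i * q.eval (r.node i) = refAverage q :=
  h q (degree_le_natDegree.trans_lt (by exact_mod_cast hq))

theorem ExactBelow.sum_weight (h : r.ExactBelow d) (hd : 0 < d) : ∑ i, r.weight i = 1 := by
  have hone := h.sum_eq (q := 1) (by rwa [natDegree_one])
  simpa only [eval_one, mul_one, refAverage_one] using hone

theorem ExactBelow.refAverage_eq_zero (h : r.ExactBelow d) {q : ℝ[X]} (hq : q.natDegree < d)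
    (hnodes : ∀ i, q.eval (r.node i) = 0) : refAverage q = 0 := by
  rw [← h.sum_eq hq]
  exact Finset.sum_eq_zero fun i _ => by rw [hnodes i, mul_zero]

theorem ExactBelow.weight_mul_eval_eq (h : r.ExactBelow d) {q : ℝ[X]} (hq : q.natDegree < d)
    {i : Fin n} (hnodes : ∀ j ≠ i, q.eval (r.node j) = 0) :
    r.weight i * q.eval (r.node i) = refAverage q := by
  rw [← h.sum_eq hq]
  symm
  exact Fintype.sum_eq_single i fun j hj => by rw [hnodes j hj, mul_zero]

theorem ExactBelow.weight_pos (h : r.ExactBelow d) {q : ℝ[X]} (hq : q.natDegree < d)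
    {i : Fin n} (hnodes : ∀ j ≠ i, q.eval (r.node j) = 0) (hi : 0 ≤ q.eval (r.node i))
    (hpos : 0 < refAverage q) : 0 < r.weight i :=
  pos_of_mul_pos_left (h.weight_mul_eval_eq hq hnodes ▸ hpos) hi

theorem IsGauss.weight_pos (h : r.IsGauss) (i : Fin n) : 0 < r.weight i := by
  set p : ℝ[X] := Lagrange.nodal (Finset.univ.erase i) r.node with hp
  have hdeg : p.natDegree + 1 = n := by
    rw [hp, Lagrange.natDegree_nodal, Finset.card_erase_add_one (Finset.mem_univ i),
      Finset.card_univ, Fintype.card_fin]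
  refine h.exact.weight_pos (q := p ^ 2) ?_ (fun j hj => ?_) ?_ ?_
  · rw [natDegree_pow]
    omega
  · rw [eval_pow, Lagrange.eval_nodal_at_node (Finset.mem_erase.2 ⟨hj, Finset.mem_univ j⟩),
      zero_pow two_ne_zero]
  · rw [eval_pow]
    positivity
  · refine refAverage_pos (pow_ne_zero 2 Lagrange.nodal_ne_zero) fun t _ => ?_
    rw [eval_pow]
    positivity

/-! ## Gauss–Lobatto weights -/

theorem IsGaussLobatto.exists_endpoints (h : r.IsGaussLobatto) :
    ∃ a b, a ≠ b ∧ r.node a = -1 ∧ r.node b = 1 := by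
  have hn := h.two_le
  refine ⟨⟨0, by omega⟩, ⟨n - 1, by omega⟩, ?_, h.first_node _ rfl,
    h.last_node _ (Nat.sub_add_cancel (by omega))⟩
  rw [Ne, Fin.mk.injEq]
  omega

theorem IsGaussLobatto.node_mem_Icc (h : r.IsGaussLobatto) (i : Fin n) :
    r.node i ∈ Set.Icc (-1 : ℝ) 1 := by
  have hn := h.two_le
  rw [← h.first_node ⟨0, by omega⟩ rfl,
    ← h.last_node ⟨n - 1, by omega⟩ (Nat.sub_add_cancel (by omega))]
  exact ⟨h.strictMono_node.monotone (Nat.zero_le _),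
    h.strictMono_node.monotone (Nat.le_sub_one_of_lt i.2)⟩

/-- The indices of the nodes other than the endpoints `±1`. -/
noncomputable def interiorIndices (r : QuadRule n) : Finset (Fin n) := {i | r.node i ^ 2 ≠ 1}

theorem mem_interiorIndices {i : Fin n} : i ∈ r.interiorIndices ↔ r.node i ^ 2 ≠ 1 := by
  simp [interiorIndices]

theorem IsGaussLobatto.card_interiorIndices (h : r.IsGaussLobatto) :
    r.interiorIndices.card + 2 = n := by
  obtain ⟨a, b, hab, ha, hb⟩ := h.exists_endpoints
  have hcompl : r.interiorIndicesᶜ = {a, b} := by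
    ext i
    rw [Finset.mem_compl, mem_interiorIndices, not_not, sq_eq_one_iff,
      Finset.mem_insert, Finset.mem_singleton, ← ha, ← hb, h.strictMono_node.injective.eq_iff,
      h.strictMono_node.injective.eq_iff, or_comm]
  rw [← Finset.card_pair hab, ← hcompl, Finset.card_add_card_compl, Fintype.card_fin]

/-- The monic polynomial `Q` whose roots are the interior nodes. For a Gauss–Lobatto rule it is
orthogonal to lower degrees for the weight `1 - t²`, so a multiple of a derivative of a Legendre
polynomial. -/
noncomputable def interiorPoly (r : QuadRule n) : ℝ[X] := Lagrange.nodal r.interiorIndices r.node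

theorem monic_interiorPoly (r : QuadRule n) : r.interiorPoly.Monic :=
  Lagrange.nodal_monic

theorem IsGaussLobatto.natDegree_interiorPoly (h : r.IsGaussLobatto) :
    r.interiorPoly.natDegree + 2 = n := by
  rw [interiorPoly, Lagrange.natDegree_nodal, h.card_interiorIndices]

theorem eval_interiorPoly_ne_zero (r : QuadRule n) {s : ℝ} (hs : s ^ 2 = 1) :
    r.interiorPoly.eval s ≠ 0 := by
  refine Lagrange.eval_nodal_not_at_node fun i hi hsi => ?_
  exact mem_interiorIndices.1 hi (hsi ▸ hs)

theorem eval_interiorPoly_eq_zero {i : Fin n} (hi : r.node i ^ 2 ≠ 1) :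
    r.interiorPoly.eval (r.node i) = 0 :=
  Lagrange.eval_nodal_at_node (mem_interiorIndices.2 hi)

theorem eval_X_sq_sub_one_mul_interiorPoly_node (r : QuadRule n) (i : Fin n) :
    ((X ^ 2 - 1) * r.interiorPoly).eval (r.node i) = 0 := by
  rw [eval_mul]
  by_cases hi : r.node i ^ 2 = 1
  · simp [hi]
  · rw [eval_interiorPoly_eq_zero hi, mul_zero]

theorem IsGaussLobatto.refAverage_mul_eq_zero (h : r.IsGaussLobatto) {q : ℝ[X]}
    (hq : q.natDegree < r.interiorPoly.natDegree) :
    refAverage ((X ^ 2 - 1) * r.interiorPoly * q) = 0 := by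
  refine h.exact.refAverage_eq_zero ?_ fun i => ?_
  · have hdeg := h.natDegree_interiorPoly
    have hle := natDegree_mul_le (p := (X ^ 2 - 1) * r.interiorPoly) (q := q)
    rw [natDegree_X_sq_sub_one_mul _ r.monic_interiorPoly.ne_zero] at hle
    omega
  · rw [eval_mul, eval_X_sq_sub_one_mul_interiorPoly_node, zero_mul]

theorem IsGaussLobatto.refAverage_derivative_mul_eq_zero (h : r.IsGaussLobatto) {q : ℝ[X]}
    (hq : q.natDegree ≤ r.interiorPoly.natDegree) :
    refAverage (derivative ((X ^ 2 - 1) * r.interiorPoly) * q) = 0 := by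
  have hright : refAverage ((X ^ 2 - 1) * r.interiorPoly * derivative q) = 0 := by
    rcases eq_or_ne q.natDegree 0 with hconst | hconst
    · rw [derivative_of_natDegree_zero hconst, mul_zero, map_zero]
    · exact h.refAverage_mul_eq_zero ((natDegree_derivative_lt hconst).trans_le hq)
  rw [refAverage_derivative_mul, hright]
  simp

end QuadRule

theorem omegaHat_pos {n : ℕ} (hn : 2 ≤ n) : 0 < omegaHat n := by
  have hn : (2 : ℝ) ≤ n := by exact_mod_cast hn
  exact one_div_pos.2 (mul_pos (by linarith) (by linarith))

theorem degree_derivative_derivative_sub_lt {P Q : ℝ[X]} (hP : P.Monic) (hQ : Q.Monic)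
    (hdeg : P.natDegree = Q.natDegree + 2) :
    (derivative (derivative P) - C ((P.natDegree : ℝ) * (P.natDegree - 1)) * Q).degree <
      Q.natDegree := by
  refine (degree_lt_iff_coeff_zero _ _).2 fun l hl => ?_
  rw [coeff_sub, coeff_C_mul, coeff_derivative, coeff_derivative]
  rcases hl.eq_or_lt with rfl | hl
  · rw [show Q.natDegree + 1 + 1 = P.natDegree from hdeg.symm, hP.coeff_natDegree,
      hQ.coeff_natDegree, hdeg]
    push_cast
    ring
  · rw [coeff_eq_zero_of_natDegree_lt (p := P) (by omega), coeff_eq_zero_of_natDegree_lt hl]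
    ring

namespace QuadRule

variable {n : ℕ} {r : QuadRule n}

/-- The derivative of Legendre's differential equation for the polynomial of degree `n - 1`. -/
theorem IsGaussLobatto.derivative_derivative_eq (h : r.IsGaussLobatto) :
    derivative (derivative ((X ^ 2 - 1) * r.interiorPoly)) =
      C ((n : ℝ) * (n - 1)) * r.interiorPoly := by
  set Q := r.interiorPoly
  set W := (X ^ 2 - 1) * Q with hW
  have hWdeg : W.natDegree = Q.natDegree + 2 :=
    natDegree_X_sq_sub_one_mul _ r.monic_interiorPoly.ne_zero
  have hWn : W.natDegree = n := hWdeg.trans h.natDegree_interiorPoly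
  rw [← hWn, ← sub_eq_zero]
  have hRdeg := degree_derivative_derivative_sub_lt (monic_X_sq_sub_one.mul r.monic_interiorPoly)
    r.monic_interiorPoly hWdeg
  set c : ℝ := W.natDegree * (W.natDegree - 1)
  set R := derivative (derivative W) - C c * Q with hR
  by_contra hR0
  have hRlt : R.natDegree < Q.natDegree := (natDegree_lt_iff_degree_lt hR0).2 hRdeg
  have horthQ : refAverage (W * R) = 0 := h.refAverage_mul_eq_zero hRlt
  have horthW : refAverage (derivative (derivative W) * ((X ^ 2 - 1) * R)) = 0 := by
    have hle := natDegree_derivative_le ((X ^ 2 - 1) * R)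
    rw [natDegree_X_sq_sub_one_mul R hR0] at hle
    have hle_Q : (derivative ((X ^ 2 - 1) * R)).natDegree ≤ Q.natDegree := by omega
    rw [refAverage_derivative_mul, h.refAverage_derivative_mul_eq_zero hle_Q]
    simp
  have hsplit : (1 - X ^ 2) * R ^ 2 =
      c • (W * R) - derivative (derivative W) * ((X ^ 2 - 1) * R) := by
    rw [smul_eq_C_mul, hW, sq R]
    nth_rw 1 [hR]
    ring
  refine (refAverage_one_sub_X_sq_mul_sq_pos hR0).ne' ?_
  rw [hsplit, map_sub, map_smul, horthQ, horthW, smul_zero, sub_zero]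

theorem IsGaussLobatto.refAverage_one_add_mul_interiorPoly (h : r.IsGaussLobatto) {s : ℝ}
    (hs : s ^ 2 = 1) :
    (n * (n - 1)) * refAverage ((1 + C s * X) * r.interiorPoly) = 2 * r.interiorPoly.eval s := by
  have hconst : refAverage (derivative ((X ^ 2 - 1) * r.interiorPoly) *
      derivative (1 + C s * X)) = 0 := by
    refine h.refAverage_derivative_mul_eq_zero ?_
    simp
  rw [← smul_eq_mul, ← map_smul, smul_eq_C_mul, mul_left_comm, ← h.derivative_derivative_eq,
    mul_comm, refAverage_derivative_mul, hconst]
  rcases sq_eq_one_iff.1 hs with rfl | rfl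
  · simp [derivative_mul]
    ring
  · simp [derivative_mul]
    ring

theorem IsGaussLobatto.eval_one_add_mul_interiorPoly_node (h : r.IsGaussLobatto) {i j : Fin n}
    (hi : r.node i ^ 2 = 1) (hij : j ≠ i) :
    ((1 + C (r.node i) * X) * r.interiorPoly).eval (r.node j) = 0 := by
  rw [eval_mul]
  by_cases hj : r.node j ^ 2 = 1
  · have hopp : r.node j = -r.node i :=
      (sq_eq_sq_iff_eq_or_eq_neg.1 (hj.trans hi.symm)).resolve_left
        (h.strictMono_node.injective.ne hij)
    have hfactor : (1 + C (r.node i) * X).eval (r.node j) = 0 := by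
      simp only [eval_add, eval_one, eval_mul, eval_C, eval_X, hopp]
      linarith
    rw [hfactor, zero_mul]
  · rw [eval_interiorPoly_eq_zero hj, mul_zero]

theorem IsGaussLobatto.weight_eq_omegaHat (h : r.IsGaussLobatto) {i : Fin n}
    (hi : r.node i ^ 2 = 1) : r.weight i = omegaHat n := by
  have hn : (2 : ℝ) ≤ n := by exact_mod_cast h.two_le
  have hdeg : ((1 + C (r.node i) * X) * r.interiorPoly).natDegree < 2 * n - 2 := by
    have hlin : (1 + C (r.node i) * X).natDegree ≤ 1 := by compute_degree
    have hle := natDegree_mul_le_of_le hlin (le_refl r.interiorPoly.natDegree)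
    have hQdeg := h.natDegree_interiorPoly
    omega
  have heval : ((1 + C (r.node i) * X) * r.interiorPoly).eval (r.node i) =
      2 * r.interiorPoly.eval (r.node i) := by
    simp only [eval_mul, eval_add, eval_one, eval_C, eval_X]
    rw [← sq, hi, one_add_one_eq_two]
  have hweight := h.refAverage_one_add_mul_interiorPoly hi
  rw [← h.exact.weight_mul_eval_eq hdeg fun j hj => h.eval_one_add_mul_interiorPoly_node hi hj,
    heval, ← mul_assoc] at hweight
  have hQ : 2 * r.interiorPoly.eval (r.node i) ≠ 0 :=
    mul_ne_zero two_ne_zero (r.eval_interiorPoly_ne_zero hi)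
  have hone := mul_right_cancel₀ hQ (hweight.trans (one_mul _).symm)
  rw [omegaHat, eq_div_iff (by nlinarith), mul_comm, hone]

theorem IsGaussLobatto.weight_pos (h : r.IsGaussLobatto) (i : Fin n) : 0 < r.weight i := by
  by_cases hi : r.node i ^ 2 = 1
  · exact h.weight_eq_omegaHat hi ▸ omegaHat_pos h.two_le
  have hmem := mem_interiorIndices.2 hi
  set p : ℝ[X] := Lagrange.nodal (r.interiorIndices.erase i) r.node with hp
  have hp0 : p ≠ 0 := Lagrange.nodal_ne_zero
  refine h.exact.weight_pos (q := (1 - X ^ 2) * p ^ 2) ?_ (fun j hj => ?_) ?_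
    (refAverage_one_sub_X_sq_mul_sq_pos hp0)
  · have hcard := h.card_interiorIndices
    have hpdeg : p.natDegree + 1 = r.interiorIndices.card := by
      rw [hp, Lagrange.natDegree_nodal, Finset.card_erase_add_one hmem]
    rw [← neg_sub, neg_mul, natDegree_neg, natDegree_X_sq_sub_one_mul _ (pow_ne_zero 2 hp0),
      natDegree_pow]
    omega
  · by_cases hj_sq : r.node j ^ 2 = 1
    · simp [hj_sq]
    · have hroot : p.eval (r.node j) = 0 :=
        Lagrange.eval_nodal_at_node (Finset.mem_erase.2 ⟨hj, mem_interiorIndices.2 hj_sq⟩)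
      simp [hroot]
  · obtain ⟨hleft, hright⟩ := h.node_mem_Icc i
    have hsq : 0 ≤ 1 - r.node i ^ 2 := by nlinarith
    simpa using mul_nonneg hsq (sq_nonneg (p.eval (r.node i)))

/-- A rule with nonnegative weights which is exact up to degree `k`, so that it writes averages as
convex combinations of values. -/
structure IsConvexRule (r : QuadRule n) (k : ℕ) : Prop where
  weight_nonneg : ∀ i, 0 ≤ r.weight i
  exact : r.ExactBelow (k + 1)

/-- Both endpoints `±1` are nodes of weight at least `ω`. -/
def EndpointWeightsGE (r : QuadRule n) (ω : ℝ) : Prop :=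
  ∃ a b, r.node a = -1 ∧ r.node b = 1 ∧ ω ≤ r.weight a ∧ ω ≤ r.weight b

variable {k : ℕ}

theorem IsGauss.isConvexRule (h : r.IsGauss) (hk : k + 1 ≤ 2 * n) : r.IsConvexRule k :=
  ⟨fun i => (h.weight_pos i).le, h.exact.mono hk⟩

theorem IsGaussLobatto.isConvexRule (h : r.IsGaussLobatto) (hk : k + 3 ≤ 2 * n) :
    r.IsConvexRule k :=
  ⟨fun i => (h.weight_pos i).le, h.exact.mono (by omega)⟩

theorem IsGaussLobatto.endpointWeightsGE (h : r.IsGaussLobatto) :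
    r.EndpointWeightsGE (omegaHat n) := by
  obtain ⟨a, b, -, ha, hb⟩ := h.exists_endpoints
  refine ⟨a, b, ha, hb, (h.weight_eq_omegaHat ?_).ge, (h.weight_eq_omegaHat ?_).ge⟩
  · rw [ha, neg_one_sq]
  · rw [hb, one_pow]

theorem EndpointWeightsGE.two_le {ω : ℝ} (h : r.EndpointWeightsGE ω) : 2 ≤ n := by
  obtain ⟨a, b, ha, hb, -⟩ := h
  have hab : a ≠ b := by
    rintro rfl
    linarith
  exact Fin.nontrivial_iff_two_le.1 ⟨a, b, hab⟩

theorem IsConvexRule.sum_weight (h : r.IsConvexRule k) : ∑ i, r.weight i = 1 :=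
  h.exact.sum_weight k.succ_pos

theorem IsConvexRule.sum_smul_mem {E : Type*} [AddCommGroup E] [Module ℝ E]
    (h : r.IsConvexRule k) {s : Set E} (hs : Convex ℝ s) {V : Fin n → E} (hV : ∀ i, V i ∈ s) :
    ∑ i, r.weight i • V i ∈ s :=
  hs.sum_mem (fun i _ => h.weight_nonneg i) h.sum_weight fun i _ => hV i

end QuadRule

/-! ## Cell averages -/

theorem cellSize_pos {x : ℤ → ℝ} (hx : StrictMono x) (j : ℤ) : 0 < cellSize x j :=
  sub_pos.2 (hx (lt_add_one j))

theorem cellPoint_neg_one (x : ℤ → ℝ) (j : ℤ) : cellPoint x j (-1) = x j := by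
  rw [cellPoint, cellSize]
  ring

theorem cellPoint_one (x : ℤ → ℝ) (j : ℤ) : cellPoint x j 1 = x (j + 1) := by
  rw [cellPoint, cellSize]
  ring

theorem refAverage_comp (p : ℝ[X]) (a : ℝ) {b : ℝ} (hb : b ≠ 0) :
    refAverage (p.comp (C a + C b * X)) =
      1 / (2 * b) * ∫ y in (a + b * -1)..(a + b * 1), p.eval y := by
  change 1 / 2 * ∫ t in (-1 : ℝ)..1, (p.comp (C a + C b * X)).eval t = _
  simp only [eval_comp, eval_add, eval_mul, eval_C, eval_X]
  rw [intervalIntegral.integral_comp_add_mul (fun y => p.eval y) hb, smul_eq_mul]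
  field_simp

theorem cellAverage_eq_refAverage {x : ℤ → ℝ} {j : ℤ} (hh : cellSize x j ≠ 0)
    (w : PiecewisePoly) :
    cellAverage x w j =
      refAverage ((w j).comp (C ((x j + x (j + 1)) / 2) + C (cellSize x j / 2) * X)) := by
  rw [refAverage_comp _ _ (div_ne_zero hh two_ne_zero), ← cellPoint, ← cellPoint,
    cellPoint_neg_one, cellPoint_one, mul_div_cancel₀ _ two_ne_zero, cellAverage]

theorem QuadRule.ExactBelow.sum_cellPoint {n d : ℕ} {r : QuadRule n} (h : r.ExactBelow d)
    {x : ℤ → ℝ} {j : ℤ} (hh : cellSize x j ≠ 0) {w : PiecewisePoly} (hw : (w j).natDegree < d) :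
    ∑ i, r.weight i * (w j).eval (cellPoint x j (r.node i)) = cellAverage x w j := by
  have hdeg : ((w j).comp
      (C ((x j + x (j + 1)) / 2) + C (cellSize x j / 2) * X)).natDegree < d := by
    have hlin : (C ((x j + x (j + 1)) / 2) + C (cellSize x j / 2) * X).natDegree ≤ 1 := by
      compute_degree
    calc _ ≤ (w j).natDegree * 1 := natDegree_comp_le.trans (Nat.mul_le_mul_left _ hlin)
      _ < d := by rwa [mul_one]
  rw [cellAverage_eq_refAverage hh, ← h.sum_eq hdeg]
  simp only [eval_comp, eval_add, eval_mul, eval_C, eval_X, cellPoint]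

theorem cellAverage_derivative (x : ℤ → ℝ) (w : PiecewisePoly) (j : ℤ) :
    cellAverage x (fun l => derivative (w l)) j =
      ((w j).eval (x (j + 1)) - (w j).eval (x j)) / cellSize x j := by
  rw [cellAverage, integral_eval_derivative, one_div, div_eq_inv_mul]

theorem InVh.natDegree_lt {J : Set ℤ} {k : ℕ} {w : PiecewisePoly} (hw : InVh J k w) {j : ℤ}
    (hj : j ∈ J) : (w j).natDegree < k + 1 :=
  Nat.lt_succ_of_le (natDegree_le_of_degree_le (hw j hj))

theorem QuadRule.IsConvexRule.stateAverage_eq {n k : ℕ} {r : QuadRule n} (h : r.IsConvexRule k)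
    {x : ℤ → ℝ} {J : Set ℤ} {U : PiecewiseState} (hU : InVh3 J k U) {j : ℤ} (hj : j ∈ J)
    (hh : cellSize x j ≠ 0) :
    stateAverage x U j = ∑ i, r.weight i • valueAt U j (cellPoint x j (r.node i)) := by
  ext l
  rw [Finset.sum_apply]
  exact (h.exact.sum_cellPoint hh ((hU l).natDegree_lt hj)).symm

theorem QuadRule.IsConvexRule.stateAverage_mem_G {n k : ℕ} {r : QuadRule n}
    (h : r.IsConvexRule k) {x : ℤ → ℝ} {J : Set ℤ} {U : PiecewiseState} (hU : InVh3 J k U) {j : ℤ}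
    (hj : j ∈ J) (hh : cellSize x j ≠ 0)
    (hUG : ∀ i, valueAt U j (cellPoint x j (r.node i)) ∈ G) : stateAverage x U j ∈ G :=
  h.stateAverage_eq hU hj hh ▸ h.sum_smul_mem convex_G hUG

/-! ## Interface fluxes -/

/-- At the interface `i` both one-sided limits of `p^e_h` are positive and both traces of `U_h`
are admissible. -/
structure AdmissibleTraces (x : ℤ → ℝ) (pe : PiecewisePoly) (U : PiecewiseState) (i : ℤ) :
    Prop where
  pressure_left : 0 < (pe (i - 1)).eval (x i)
  pressure_right : 0 < (pe i).eval (x i)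
  state_left : valueAt U (i - 1) (x i) ∈ G
  state_right : valueAt U i (x i) ∈ G

/-- The largest wave speed of the four traces at the two interfaces of the cell `j`. -/
noncomputable def maxTraceSpeed (γ : ℝ) (x : ℤ → ℝ) (U : PiecewiseState) (j : ℤ) : ℝ :=
  max (max (alphaMax γ (valueAt U (j - 1) (x j))) (alphaMax γ (valueAt U j (x j))))
    (max (alphaMax γ (valueAt U j (x (j + 1)))) (alphaMax γ (valueAt U (j + 1) (x (j + 1)))))

section Interfaces

variable {γ : ℝ} {x : ℤ → ℝ} {pe : PiecewisePoly} {U : PiecewiseState} {j : ℤ}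

theorem alphaF_eq (γ : ℝ) (x : ℤ → ℝ) (pe : PiecewisePoly) (U : PiecewiseState) (j : ℤ) :
    alphaF γ x pe U j =
      max (pStar x pe (j + 1) / (pe j).eval (x (j + 1))) (pStar x pe j / (pe j).eval (x j)) *
        (2 * maxTraceSpeed γ x U j) := by
  rw [alphaF, maxTraceSpeed, mul_comm 2, mul_assoc]

theorem AdmissibleTraces.pStar_pos (h : AdmissibleTraces x pe U j) : 0 < pStar x pe j :=
  half_pos (add_pos h.pressure_left h.pressure_right)

theorem AdmissibleTraces.smul_left_sub_modifiedFlux_mem_G (h : AdmissibleTraces x pe U j)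
    (hγ : 1 < γ) {a A : ℝ} (hL : alphaMax γ (valueAt U (j - 1) (x j)) ≤ a)
    (hR : alphaMax γ (valueAt U j (x j)) ≤ a)
    (hA : pStar x pe j / (pe (j - 1)).eval (x j) * (2 * a) ≤ A) :
    A • valueAt U (j - 1) (x j) - modifiedFlux γ x pe U j ∈ G := by
  have hcL := div_pos h.pStar_pos h.pressure_left
  have hcR := div_pos h.pStar_pos h.pressure_right
  convert add_mem_G
    (smul_left_sub_hllc_mem_G hγ (smul_mem_G h.state_left hcL) (smul_mem_G h.state_right hcR)
      ((alphaMax_smul γ hcL.ne' _).trans_le hL) ((alphaMax_smul γ hcR.ne' _).trans_le hR))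
    (smul_mem_admissibleCone h.state_left (sub_nonneg.2 hA)) using 1
  rw [modifiedFlux]
  module

theorem AdmissibleTraces.smul_right_add_modifiedFlux_mem_G (h : AdmissibleTraces x pe U j)
    (hγ : 1 < γ) {a A : ℝ} (hL : alphaMax γ (valueAt U (j - 1) (x j)) ≤ a)
    (hR : alphaMax γ (valueAt U j (x j)) ≤ a)
    (hA : pStar x pe j / (pe j).eval (x j) * (2 * a) ≤ A) :
    A • valueAt U j (x j) + modifiedFlux γ x pe U j ∈ G := by
  have hcL := div_pos h.pStar_pos h.pressure_left
  have hcR := div_pos h.pStar_pos h.pressure_right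
  convert add_mem_G
    (smul_right_add_hllc_mem_G hγ (smul_mem_G h.state_left hcL) (smul_mem_G h.state_right hcR)
      ((alphaMax_smul γ hcL.ne' _).trans_le hL) ((alphaMax_smul γ hcR.ne' _).trans_le hR))
    (smul_mem_admissibleCone h.state_right (sub_nonneg.2 hA)) using 1
  rw [modifiedFlux]
  module

theorem AdmissibleTraces.maxTraceSpeed_pos (h : AdmissibleTraces x pe U j) (hγ : 1 < γ) :
    0 < maxTraceSpeed γ x U j :=
  (alphaMax_pos hγ h.state_left).trans_le ((le_max_left _ _).trans (le_max_left _ _))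

theorem AdmissibleTraces.alphaF_nonneg (h : AdmissibleTraces x pe U j) (hγ : 1 < γ) :
    0 ≤ alphaF γ x pe U j := by
  rw [alphaF_eq]
  have hratio := (div_pos h.pStar_pos h.pressure_right).le
  exact mul_nonneg (hratio.trans (le_max_right _ _))
    (mul_nonneg zero_le_two (h.maxTraceSpeed_pos hγ).le)

theorem alphaF_smul_sub_modifiedFlux_mem_G (hγ : 1 < γ) (hl : AdmissibleTraces x pe U j)
    (hr : AdmissibleTraces x pe U (j + 1)) :
    alphaF γ x pe U j • valueAt U j (x (j + 1)) - modifiedFlux γ x pe U (j + 1) ∈ G := by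
  have hM := hl.maxTraceSpeed_pos hγ
  have hflux := hr.smul_left_sub_modifiedFlux_mem_G hγ (a := maxTraceSpeed γ x U j)
    (A := alphaF γ x pe U j)
  rw [add_sub_cancel_right] at hflux
  refine hflux ((le_max_left _ _).trans (le_max_right _ _))
    ((le_max_right _ _).trans (le_max_right _ _)) ?_
  rw [alphaF_eq]
  gcongr
  exact le_max_left _ _

theorem alphaF_smul_add_modifiedFlux_mem_G (hγ : 1 < γ) (hl : AdmissibleTraces x pe U j) :
    alphaF γ x pe U j • valueAt U j (x j) + modifiedFlux γ x pe U j ∈ G := by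
  have hM := hl.maxTraceSpeed_pos hγ
  refine hl.smul_right_add_modifiedFlux_mem_G hγ (a := maxTraceSpeed γ x U j)
    ((le_max_left _ _).trans (le_max_left _ _)) ((le_max_right _ _).trans (le_max_left _ _)) ?_
  rw [alphaF_eq]
  gcongr
  exact le_max_right _ _

end Interfaces

/-! ## Evolution of the cell averages -/

theorem sum_smul_sub_endpoints_mem_admissibleCone {ι : Type*} [Fintype ι]
    {w : ι → ℝ} (hw : ∀ i, 0 ≤ w i) {V : ι → State} (hV : ∀ i, V i ∈ G) {a b : ι} (hab : a ≠ b)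
    {ω : ℝ} (ha : ω ≤ w a) (hb : ω ≤ w b) :
    ∑ i, w i • V i - ω • (V a + V b) ∈ admissibleCone := by
  classical
  have hrest : ∑ i ∈ {a, b}ᶜ, w i • V i ∈ admissibleCone :=
    sum_mem fun i _ => smul_mem_admissibleCone (hV i) (hw i)
  convert add_mem (add_mem (smul_mem_admissibleCone (hV a) (sub_nonneg.2 ha))
    (smul_mem_admissibleCone (hV b) (sub_nonneg.2 hb))) hrest using 1
  rw [← Finset.sum_add_sum_compl {a, b}, Finset.sum_pair hab]
  module

theorem smul_sum_add_sum_gravitySource_mem_admissibleCone {ι : Type*} [Fintype ι] {w : ι → ℝ}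
    (hw : ∀ i, 0 ≤ w i) {V : ι → State} (hV : ∀ i, V i ∈ G) {a : ι → ℝ} {s : ℝ}
    (ha : ∀ i, |a i| ≤ s * √(2 * internalEnergy (V i))) :
    s • ∑ i, w i • V i + ∑ i, w i • a i • gravitySource (V i) ∈ admissibleCone := by
  rw [Finset.smul_sum, ← Finset.sum_add_distrib]
  refine sum_mem fun i _ => ?_
  rw [smul_comm s, ← smul_add]
  exact PointedCone.smul_mem _ (hw i) (smul_add_gravitySource_mem_admissibleCone (hV i) (ha i))

section Scheme

variable {γ : ℝ} {k N L : ℕ} {r : QuadRule N} {s : QuadRule L} {x : ℤ → ℝ} {J : Set ℤ}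
  {ρe pe : PiecewisePoly} {U : PiecewiseState} {j : ℤ}

/-- Exactness turns the terms with the averages into `-∫ (p^e_h)_x` plus a difference of interface
values, and this is a mean of jumps. -/
theorem sourceForm_one (hr : r.IsConvexRule k) (hpe : InVh J k pe) (hj : j ∈ J)
    (hh : cellSize x j ≠ 0) (q : PiecewisePoly) :
    sourceForm r x ρe pe q j 1 =
      cellSize x j * ∑ μ, r.weight μ *
        ((derivative (pe j)).eval (cellPoint x j (r.node μ)) /
            (ρe j).eval (cellPoint x j (r.node μ)) * (q j).eval (cellPoint x j (r.node μ)))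
      + (jump x pe (j + 1) + jump x pe j) / (2 * cellAverage x ρe j) * cellAverage x q j := by
  have hdeg : (derivative (pe j)).natDegree < k + 1 :=
    ((natDegree_derivative_le _).trans (Nat.sub_le _ _)).trans_lt (hpe.natDegree_lt hj)
  have hexact := hr.exact.sum_cellPoint hh (w := fun l => derivative (pe l)) hdeg
  rw [cellAverage_derivative, eq_div_iff hh, mul_comm] at hexact
  have hsplit : ∑ μ, r.weight μ * (((q j).eval (cellPoint x j (r.node μ)) /
          (ρe j).eval (cellPoint x j (r.node μ)) - cellAverage x q j / cellAverage x ρe j) *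
        (derivative (pe j)).eval (cellPoint x j (r.node μ))) =
      ∑ μ, r.weight μ * ((derivative (pe j)).eval (cellPoint x j (r.node μ)) /
          (ρe j).eval (cellPoint x j (r.node μ)) * (q j).eval (cellPoint x j (r.node μ))) -
        cellAverage x q j / cellAverage x ρe j *
          ∑ μ, r.weight μ * (derivative (pe j)).eval (cellPoint x j (r.node μ)) := by
    rw [Finset.mul_sum, ← Finset.sum_sub_distrib]
    exact Finset.sum_congr rfl fun μ _ => by ring
  simp only [sourceForm, eval_one, derivative_one, eval_zero, mul_zero, Finset.sum_const_zero,
    mul_one, sub_zero]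
  rw [hsplit, mul_sub, mul_left_comm (cellSize x j), hexact, pStar, pStar, jump, jump,
    add_sub_cancel_right]
  ring

theorem sourceVector_one (hr : r.IsConvexRule k) (hpe : InVh J k pe) (hj : j ∈ J)
    (hh : cellSize x j ≠ 0) :
    sourceVector r x ρe pe U j 1 =
      cellSize x j • ∑ μ, r.weight μ •
        ((derivative (pe j)).eval (cellPoint x j (r.node μ)) /
            (ρe j).eval (cellPoint x j (r.node μ))) •
          gravitySource (valueAt U j (cellPoint x j (r.node μ)))
      + ((jump x pe (j + 1) + jump x pe j) / (2 * cellAverage x ρe j)) •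
        gravitySource (stateAverage x U j) := by
  rw [sourceVector, sourceForm_one hr hpe hj hh, sourceForm_one hr hpe hj hh]
  ext i
  fin_cases i <;> simp [Finset.sum_apply, gravitySource, valueAt, stateAverage]

theorem flux_update_mem_G (hγ : 1 < γ) (hs : s.IsConvexRule k)
    (hends : s.EndpointWeightsGE (omegaHat L)) (hh : 0 < cellSize x j) (hU : InVh3 J k U)
    (hj : j ∈ J) (hUG : ∀ ν, valueAt U j (cellPoint x j (s.node ν)) ∈ G)
    (hl : AdmissibleTraces x pe U j) (hr : AdmissibleTraces x pe U (j + 1)) :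
    (alphaF γ x pe U j / (omegaHat L * cellSize x j)) • stateAverage x U j
      - (1 / cellSize x j) • (modifiedFlux γ x pe U (j + 1) - modifiedFlux γ x pe U j) ∈ G := by
  have hω := omegaHat_pos hends.two_le
  obtain ⟨a, b, ha, hb, hωa, hωb⟩ := hends
  have hab : a ≠ b := by
    rintro rfl
    linarith
  have hinterior := sum_smul_sub_endpoints_mem_admissibleCone hs.weight_nonneg hUG hab hωa hωb
  rw [← hs.stateAverage_eq hU hj hh.ne', ha, hb, cellPoint_neg_one, cellPoint_one] at hinterior
  have hleft := smul_mem_G (alphaF_smul_add_modifiedFlux_mem_G hγ hl) (one_div_pos.2 hh)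
  have hright := smul_mem_G (alphaF_smul_sub_modifiedFlux_mem_G hγ hl hr) (one_div_pos.2 hh)
  have hcoeff : 0 ≤ alphaF γ x pe U j / (omegaHat L * cellSize x j) :=
    div_nonneg (hl.alphaF_nonneg hγ) (mul_pos hω hh).le
  convert add_mem_G hleft (add_mem (G_subset_admissibleCone hright)
    (PointedCone.smul_mem _ hcoeff hinterior)) using 1
  have hscale : alphaF γ x pe U j / (omegaHat L * cellSize x j) * omegaHat L =
      1 / cellSize x j * alphaF γ x pe U j := by
    field_simp
  rw [smul_sub (alphaF γ x pe U j / _), smul_smul _ (omegaHat L), hscale]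
  module

theorem source_update_mem_admissibleCone (hr : r.IsConvexRule k) (hω : omegaHat L ≠ 0)
    (hh : cellSize x j ≠ 0) (hU : InVh3 J k U) (hj : j ∈ J)
    (hρe : ∀ μ, 0 < (ρe j).eval (cellPoint x j (r.node μ)))
    (hUG : ∀ μ, valueAt U j (cellPoint x j (r.node μ)) ∈ G) :
    (alphaS L r x ρe pe U j / (omegaHat L * cellSize x j)) • stateAverage x U j
      + ∑ μ, r.weight μ •
        ((derivative (pe j)).eval (cellPoint x j (r.node μ)) /
            (ρe j).eval (cellPoint x j (r.node μ))) •
          gravitySource (valueAt U j (cellPoint x j (r.node μ))) ∈ admissibleCone := by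
  rw [alphaS, mul_div_cancel_left₀ _ (mul_ne_zero hω hh), hr.stateAverage_eq hU hj hh]
  refine smul_sum_add_sum_gravitySource_mem_admissibleCone hr.weight_nonneg hUG fun μ => ?_
  rw [abs_div, abs_of_pos (hρe μ), ← div_le_iff₀ (sqrt_two_mul_internalEnergy_pos (hUG μ)),
    div_div]
  exact le_ciSup (f := fun μ => |(derivative (pe j)).eval (cellPoint x j (r.node μ))| /
    ((ρe j).eval (cellPoint x j (r.node μ)) *
      √(2 * internalEnergy (valueAt U j (cellPoint x j (r.node μ))))))
    (Set.finite_range _).bddAbove μ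

theorem average_source_update_mem_admissibleCone (hω : omegaHat L ≠ 0) (hh : 0 < cellSize x j)
    (hρe : 0 < cellAverage x ρe j) (hUG : stateAverage x U j ∈ G) :
    (alphaSBar L x ρe pe U j / (omegaHat L * cellSize x j)) • stateAverage x U j
      + (1 / cellSize x j * ((jump x pe (j + 1) + jump x pe j) / (2 * cellAverage x ρe j))) •
        gravitySource (stateAverage x U j) ∈ admissibleCone := by
  have hsqrt := sqrt_two_mul_internalEnergy_pos hUG
  refine smul_add_gravitySource_mem_admissibleCone hUG (le_of_eq ?_)
  rw [abs_mul, abs_div (_ + _), abs_of_pos (one_div_pos.2 hh),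
    abs_of_pos (mul_pos two_pos hρe), alphaSBar]
  field_simp

theorem alphaTilde_smul_add_averageOperator_mem_G (hγ : 1 < γ) (hr : r.IsConvexRule k)
    (hs : s.IsConvexRule k) (hends : s.EndpointWeightsGE (omegaHat L)) (hh : 0 < cellSize x j)
    (hρe : InVh J k ρe) (hpe : InVh J k pe) (hU : InVh3 J k U) (hj : j ∈ J)
    (hρe_pos : ∀ μ, 0 < (ρe j).eval (cellPoint x j (r.node μ)))
    (hUG : ∀ y ∈ pointSet r s x j, valueAt U j y ∈ G)
    (hleft : AdmissibleTraces x pe U j) (hright : AdmissibleTraces x pe U (j + 1)) :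
    (alphaTilde L γ r x ρe pe U j / (omegaHat L * cellSize x j)) • stateAverage x U j
      + averageOperator γ r x ρe pe U j ∈ G := by
  have hω := (omegaHat_pos hends.two_le).ne'
  have hUG_r : ∀ μ, valueAt U j (cellPoint x j (r.node μ)) ∈ G := fun μ => hUG _ (.inr ⟨μ, rfl⟩)
  have hUG_s : ∀ ν, valueAt U j (cellPoint x j (s.node ν)) ∈ G := fun ν => hUG _ (.inl ⟨ν, rfl⟩)
  have hρe_avg : 0 < cellAverage x ρe j := by
    rw [← hr.exact.sum_cellPoint hh.ne' (hρe.natDegree_lt hj)]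
    exact hr.sum_smul_mem (convex_Ioi (0 : ℝ)) hρe_pos
  have hU_avg := hr.stateAverage_mem_G hU hj hh.ne' hUG_r
  convert add_mem_G (flux_update_mem_G hγ hs hends hh hU hj hUG_s hleft hright)
    (add_mem
      (source_update_mem_admissibleCone (pe := pe) hr hω hh.ne' hU hj hρe_pos hUG_r)
      (average_source_update_mem_admissibleCone (pe := pe) hω hh hρe_avg hU_avg)) using 1
  rw [alphaTilde, averageOperator, sourceVector_one hr hpe hj hh.ne', smul_add (1 / cellSize x j),
    smul_smul (1 / cellSize x j) (cellSize x j), one_div_mul_cancel hh.ne']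
  module

theorem stateAverage_add_smul_averageOperator_mem_G {c Δt : ℝ} (hU : stateAverage x U j ∈ G)
    (hL : c • stateAverage x U j + averageOperator γ r x ρe pe U j ∈ G) (hΔt : 0 < Δt)
    (hc : c * Δt ≤ 1) :
    stateAverage x U j + Δt • averageOperator γ r x ρe pe U j ∈ G := by
  convert add_mem_G (smul_mem_G hL hΔt) (smul_mem_admissibleCone hU (sub_nonneg.2 hc)) using 1
  module

theorem weakRHS_one :
    weakRHS γ r x ρe pe U j 1 =
      -(modifiedFlux γ x pe U (j + 1) - modifiedFlux γ x pe U j)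
        + sourceVector r x ρe pe U j 1 := by
  simp only [weakRHS, derivative_one, eval_zero, eval_one, mul_zero, zero_smul, one_smul,
    Finset.sum_const_zero, smul_zero, zero_sub]

theorem IsForwardEulerStep.stateAverage_eq {Δt : ℝ} {Unew : PiecewiseState}
    (h : IsForwardEulerStep J k γ r x ρe pe Δt U Unew) (hj : j ∈ J) :
    stateAverage x Unew j = stateAverage x U j + Δt • averageOperator γ r x ρe pe U j := by
  ext i
  have hweak := h.2 j hj 1 (degree_one_le.trans (Nat.cast_nonneg k)) i
  simp only [eval_one, mul_one] at hweak
  have hop : averageOperator γ r x ρe pe U j =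
      (1 / cellSize x j) • weakRHS γ r x ρe pe U j 1 := by
    rw [averageOperator, weakRHS_one, smul_add, smul_neg]
  simp only [stateAverage, cellAverage, Pi.add_apply, Pi.smul_apply, smul_eq_mul, hop, hweak]
  ring

end Scheme

theorem QuadRule.EndpointWeightsGE.endpoints_mem_pointSet {N L : ℕ} {r : QuadRule N}
    {s : QuadRule L} {ω : ℝ} (h : s.EndpointWeightsGE ω) (x : ℤ → ℝ) (j : ℤ) :
    x j ∈ pointSet r s x j ∧ x (j + 1) ∈ pointSet r s x j := by
  obtain ⟨a, b, ha, hb, -⟩ := h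
  exact ⟨.inl ⟨a, by simp only [ha, cellPoint_neg_one]⟩,
    .inl ⟨b, by simp only [hb, cellPoint_one]⟩⟩

theorem admissibleTraces_of_pointSet {N L : ℕ} {r : QuadRule N} {s : QuadRule L} {ω : ℝ}
    (hs : s.EndpointWeightsGE ω) {x : ℤ → ℝ} {J : Set ℤ} {pe : PiecewisePoly} {U : PiecewiseState}
    (hpoints : ∀ j ∈ J, ∀ y ∈ pointSet r s x j, 0 < (pe j).eval y ∧ valueAt U j y ∈ G)
    (hleft : ∀ j ∈ J, j - 1 ∉ J → 0 < (pe (j - 1)).eval (x j) ∧ valueAt U (j - 1) (x j) ∈ G)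
    (hright : ∀ j ∈ J, j + 1 ∉ J →
      0 < (pe (j + 1)).eval (x (j + 1)) ∧ valueAt U (j + 1) (x (j + 1)) ∈ G)
    {j : ℤ} (hj : j ∈ J) : AdmissibleTraces x pe U j ∧ AdmissibleTraces x pe U (j + 1) := by
  have hstart : ∀ l ∈ J, 0 < (pe l).eval (x l) ∧ valueAt U l (x l) ∈ G := fun l hl =>
    hpoints l hl _ (hs.endpoints_mem_pointSet x l).1
  have hend : ∀ l ∈ J, 0 < (pe l).eval (x (l + 1)) ∧ valueAt U l (x (l + 1)) ∈ G := fun l hl =>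
    hpoints l hl _ (hs.endpoints_mem_pointSet x l).2
  have hprev : 0 < (pe (j - 1)).eval (x j) ∧ valueAt U (j - 1) (x j) ∈ G := by
    by_cases h : j - 1 ∈ J
    · simpa only [sub_add_cancel] using hend (j - 1) h
    · exact hleft j hj h
  have hnext : 0 < (pe (j + 1)).eval (x (j + 1)) ∧ valueAt U (j + 1) (x (j + 1)) ∈ G := by
    by_cases h : j + 1 ∈ J
    · exact hstart (j + 1) h
    · exact hright j hj h
  have hlast : 0 < (pe (j + 1 - 1)).eval (x (j + 1)) ∧ valueAt U (j + 1 - 1) (x (j + 1)) ∈ G := by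
    rw [add_sub_cancel_right]
    exact hend j hj
  exact ⟨⟨hprev.1, (hstart j hj).1, hprev.2, (hstart j hj).2⟩,
    ⟨hlast.1, hnext.1, hlast.2, hnext.2⟩⟩

end WBDG

theorem mainTheorem1_general (γ : ℝ) (hγ : 1 < γ) (k N L : ℕ)
    (r : WBDG.QuadRule N) (hr : r.IsConvexRule k)
    (s : WBDG.QuadRule L) (hs : s.IsConvexRule k) (hends : s.EndpointWeightsGE (WBDG.omegaHat L))
    (x : ℤ → ℝ) (hx : StrictMono x) (J : Set ℤ)
    (ρe pe : WBDG.PiecewisePoly) (hρe : WBDG.InVh J k ρe) (hpe : WBDG.InVh J k pe)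
    (U : WBDG.PiecewiseState) (hU : WBDG.InVh3 J k U)
    (hρe_pos : ∀ j ∈ J, ∀ μ, 0 < (ρe j).eval (WBDG.cellPoint x j (r.node μ)))
    (hUG : ∀ j ∈ J, ∀ y ∈ WBDG.pointSet r s x j, WBDG.valueAt U j y ∈ WBDG.G)
    (htraces : ∀ j ∈ J,
      WBDG.AdmissibleTraces x pe U j ∧ WBDG.AdmissibleTraces x pe U (j + 1))
    (Δt : ℝ) (hΔt : 0 < Δt)
    (hCFL : ∀ j ∈ J, WBDG.alphaTilde L γ r x ρe pe U j * Δt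
      ≤ WBDG.omegaHat L * WBDG.cellSize x j) :
    (∀ j ∈ J, WBDG.stateAverage x U j + Δt • WBDG.averageOperator γ r x ρe pe U j ∈ WBDG.G) ∧
      (∀ Unew : WBDG.PiecewiseState,
        WBDG.IsForwardEulerStep J k γ r x ρe pe Δt U Unew →
          ∀ j ∈ J, WBDG.stateAverage x Unew j ∈ WBDG.G) := by
  have hupdate : ∀ j ∈ J,
      WBDG.stateAverage x U j + Δt • WBDG.averageOperator γ r x ρe pe U j ∈ WBDG.G := by
    intro j hj
    have hh := WBDG.cellSize_pos hx j
    have hU_avg : WBDG.stateAverage x U j ∈ WBDG.G :=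
      hr.stateAverage_mem_G hU hj hh.ne' fun μ => hUG j hj _ (.inr ⟨μ, rfl⟩)
    refine WBDG.stateAverage_add_smul_averageOperator_mem_G hU_avg
      (WBDG.alphaTilde_smul_add_averageOperator_mem_G hγ hr hs hends hh hρe hpe hU hj
        (hρe_pos j hj) (hUG j hj) (htraces j hj).1 (htraces j hj).2) hΔt ?_
    rw [div_mul_eq_mul_div]
    exact (div_le_one (mul_pos (WBDG.omegaHat_pos hends.two_le) hh)).2 (hCFL j hj)
  refine ⟨hupdate, fun Unew hstep j hj => ?_⟩
  rw [hstep.stateAverage_eq hj]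
  exact hupdate j hj

theorem mainTheorem1
    -- adiabatic index, polynomial degree, Gauss rule and Gauss–Lobatto rule
    (γ : ℝ) (hγ : 1 < γ) (k N L : ℕ) (hN : k + 1 ≤ 2 * N) (hL : k + 3 ≤ 2 * L)
    (gauss : WBDG.QuadRule N) (hgauss : gauss.IsGauss)
    (lobatto : WBDG.QuadRule L) (hlobatto : lobatto.IsGaussLobatto)
    -- mesh and the set of the cells of the domain
    (x : ℤ → ℝ) (hx : StrictMono x) (J : Set ℤ)
    -- discrete equilibrium and numerical solution
    (ρe pe : WBDG.PiecewisePoly) (hρe : WBDG.InVh J k ρe) (hpe : WBDG.InVh J k pe)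
    (U : WBDG.PiecewiseState) (hU : WBDG.InVh3 J k U)
    -- positivity of the equilibrium and admissibility of the solution at the points of each cell
    (hePos : ∀ j ∈ J, ∀ y ∈ WBDG.pointSet gauss lobatto x j,
      0 < (ρe j).eval y ∧ 0 < (pe j).eval y)
    (hUG : ∀ j ∈ J, ∀ y ∈ WBDG.pointSet gauss lobatto x j, WBDG.valueAt U j y ∈ WBDG.G)
    -- the same for the exterior traces supplied by the boundary conditions, if there is a boundary
    (hleft : ∀ j ∈ J, j - 1 ∉ J →
      0 < (pe (j - 1)).eval (x j) ∧ WBDG.valueAt U (j - 1) (x j) ∈ WBDG.G)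
    (hright : ∀ j ∈ J, j + 1 ∉ J →
      0 < (pe (j + 1)).eval (x (j + 1)) ∧ WBDG.valueAt U (j + 1) (x (j + 1)) ∈ WBDG.G)
    -- time step and CFL condition
    (Δt : ℝ) (hΔt : 0 < Δt)
    (hCFL : ∀ j ∈ J, WBDG.alphaTilde L γ gauss x ρe pe U j * Δt
      ≤ WBDG.omegaHat L * WBDG.cellSize x j) :
    (∀ j ∈ J, WBDG.stateAverage x U j + Δt • WBDG.averageOperator γ gauss x ρe pe U j ∈ WBDG.G) ∧
      (∀ Unew : WBDG.PiecewiseState,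
        WBDG.IsForwardEulerStep J k γ gauss x ρe pe Δt U Unew →
          ∀ j ∈ J, WBDG.stateAverage x Unew j ∈ WBDG.G) := by
  have hends := hlobatto.endpointWeightsGE
  have htraces : ∀ j ∈ J,
      WBDG.AdmissibleTraces x pe U j ∧ WBDG.AdmissibleTraces x pe U (j + 1) := fun j hj =>
    WBDG.admissibleTraces_of_pointSet hends (fun l hl y hy => ⟨(hePos l hl y hy).2, hUG l hl y hy⟩)
      hleft hright hj
  exact mainTheorem1_general γ hγ k N L gauss (hgauss.isConvexRule hN) lobatto
    (hlobatto.isConvexRule hL) hends x hx J ρe pe hρe hpe U hU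
    (fun j hj μ => (hePos j hj _ (.inr ⟨μ, rfl⟩)).1) hUG htraces Δt hΔt hCFL
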